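/- **Setting.** Let $n\ge 1$, $B>0$, $\sigma\ge 0$, $\delta\in(0,1)$. Before the game an adversary fixes points $x_1<\dots<x_n$ in $\mathbb R$, a function $f$ with $|f(x_j)|\le B$ for all $j\in[n]=\{1,\dots,n\}$ and $\sum_{j=2}^n|f(x_j)-f(x_{j-1})|\le C_n$, and an arbitrary sequence of indices $i_1,\dots,i_n\in[n]$ (repetitions allowed). In round $t=1,\dots,n$ the index $i_t$ is revealed, the player forecasts $\hat y_t$, and then observes $y_t=f(x_{i_t})+\epsilon_t$, where $\epsilon_1,\dots,\epsilon_n$ are i.i.d. $N(0,\sigma^2)$. **Algorithm.** Let $\mathcal E_n$ be the set of all intervals of integers $[i2^k,(i+1)2^k-1]$, $k\ge 0$, $i\ge 1$, that are contained in $[n]$. For $I\in\mathcal E_n$ let $\mathcal A_I(t)$ be the average of those $y_s$ with $s<t$ and $i_s\in I$ (and $\mathcal A_I(t)=0$ if there are none). ALIGATOR with learning rate $\eta$ starts from $u_{1,I}=1/|\mathcal E_n|$ for all $I \in \mathcal E_n$. In round $t$, with $A_t=\{I\in\mathcal E_n: i_t\in I\}$, it forecasts $$\hat y_t=\sum_{I\in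 A_t}w_{t,I}\,\mathcal A_I(t),\qquad w_{t,I}=\frac{u_{t,I}}{\sum_{J\in A_t}u_{t,J}},$$ and, after seeing $y_t$, sets $\ell_{t,I}=\eta\,(y_t-\mathcal A_I(t))^2$ and $$u_{t+1,I}=\frac{u_{t,I}e^{-\ell_{t,I}}}{\sum_{J\in A_t}u_{t,J}e^{-\ell_{t,J}}}\sum_{J\in A_t}u_{t,J}\ \ (I\in A_t),\qquad u_{t+1,I}=u_{t,I}\ \ (I\notin A_t).$$ **Theorem.** There is a universal exponent $p\in\mathbb N$, and for all $B>0$, $\sigma\ge0$ there is a constant $K=K(B,\sigma)$, such that for all $n\ge1$, all $\delta\in(0,1)$, all $C_n$ and all choices of the adversary as above, ALIGATOR run with $$\eta=\frac{1}{8\left(B+\sigma\sqrt{\log(2n/\delta)}\right)^2}$$ satisfies, with probability at least $1-\delta$, $$\sum_{t=1}^n\bigl(\hat y_t-f(x_{i_t})\bigr)^2\;\le\;K\,\bigl(1+\log(n/\delta)\bigr)^p\,\max\bigl\{1,\;n^{1/3}C_n^{2/3}\bigr\}.$$ In particular the algorithm does not need to know $C_n$. -/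

import Mathlib

open MeasureTheory ProbabilityTheory

namespace Aligator

/-- The geometric cover `𝓘 = ⋃ₖ 𝓘ₖ`, `𝓘ₖ = {[i·2ᵏ, (i+1)·2ᵏ - 1] : i ≥ 1}`, a collection of
intervals of positive integers. -/
def geometricCover : Set (Finset ℕ) :=
  {I | ∃ k i : ℕ, 1 ≤ i ∧ I = Finset.Icc (i * 2 ^ k) ((i + 1) * 2 ^ k - 1)}

open Classical in
/-- The pool `𝓘|_{[n]}`: the intervals of the geometric cover contained in `{1, …, n}`.
An interval is the name of its expert. -/
noncomputable def pool (n : ℕ) : Finset (Finset ℕ) :=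
  (Finset.Icc 1 n).powerset.filter (fun I => I ∈ geometricCover)

/-- The experts of the pool that are awake when the index `j` is queried. -/
noncomputable def awake (n j : ℕ) : Finset (Finset ℕ) :=
  (pool n).filter (fun I => j ∈ I)

section SAA

variable {κ : Type*} [DecidableEq κ]

/-- The Specialist Aggregation Algorithm on the pool `S`, with awake sets `A t` and losses `ℓ t k`
in the rounds `t = 1, 2, …`. `saaU S A ℓ s` is the vector of (unnormalized) weights after `s`
completed rounds, that is, the vector `u_{s+1}` used in round `s + 1`; initially it is
`1 / |S|` in every coordinate. -/
noncomputable def saaU (S : Finset κ) (A : ℕ → Finset κ) (ℓ : ℕ → κ → ℝ) : ℕ → κ → ℝ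
  | 0 => fun _ => 1 / (S.card : ℝ)
  | s + 1 => fun k =>
      if k ∈ A (s + 1) then
        saaU S A ℓ s k * Real.exp (-ℓ (s + 1) k)
            / (∑ j ∈ A (s + 1), saaU S A ℓ s j * Real.exp (-ℓ (s + 1) j))
          * ∑ j ∈ A (s + 1), saaU S A ℓ s j
      else saaU S A ℓ s k

/-- The distribution `w_t` over the awake experts played in round `t ≥ 1`. -/
noncomputable def saaW (S : Finset κ) (A : ℕ → Finset κ) (ℓ : ℕ → κ → ℝ) (t : ℕ) (k : κ) : ℝ :=
  (if k ∈ A t then saaU S A ℓ (t - 1) k else 0) / ∑ j ∈ A t, saaU S A ℓ (t - 1) j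

end SAA

/-- The online-averaging expert `𝒜_I(t)`: the mean of the observations `y s`, `1 ≤ s < t`, whose
queried index `i s` lies in `I`, and `0` if there is none. -/
noncomputable def expert (i : ℕ → ℕ) (y : ℕ → ℝ) (I : Finset ℕ) (t : ℕ) : ℝ :=
  if 0 < ((Finset.Ico 1 t).filter (fun s => i s ∈ I)).card then
    (∑ s ∈ (Finset.Ico 1 t).filter (fun s => i s ∈ I), y s)
      / (((Finset.Ico 1 t).filter (fun s => i s ∈ I)).card : ℝ)
  else 0

/-- The loss `η (y_t - 𝒜_I(t))²` that is passed to the aggregation algorithm. -/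
noncomputable def loss (η : ℝ) (i : ℕ → ℕ) (y : ℕ → ℝ) (t : ℕ) (I : Finset ℕ) : ℝ :=
  η * (y t - expert i y I t) ^ 2

/-- The forecast `ŷ_t` of ALIGATOR in round `t` (`1 ≤ t ≤ n`), with horizon `n`, learning rate `η`,
queried indices `i 1, i 2, …` and observations `y 1, y 2, …`. It depends only on `i 1, …, i t` and
`y 1, …, y (t - 1)`. -/
noncomputable def forecast (n : ℕ) (η : ℝ) (i : ℕ → ℕ) (y : ℕ → ℝ) (t : ℕ) : ℝ :=
  ∑ I ∈ awake n (i t),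
    saaW (pool n) (fun s => awake n (i s)) (loss η i y) t I * expert i y I t

/-- The learning rate `1 / (8 (B + σ √(log (2n/δ)))²)`. -/
noncomputable def rate (B σ δ : ℝ) (n : ℕ) : ℝ :=
  1 / (8 * (B + σ * √(Real.log (2 * n / δ))) ^ 2)

end Aligator

/-! The comparator is piecewise constant. Split `[n]` into the maximal dyadic intervals on which
(variation of `f`)² × (number of rounds querying the interval) is at most 1, and let `c` take the
value of `f` at the left endpoint of each. An interval whose parent lies inside `[n]` has a parent
violating this bound. For one scale, Hölder applied to `∑ V^(2/3) N^(1/3)`, with `∑ V ≤ C` and `∑ N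
≤ n`, bounds the number of violators by `n^(1/3) C^(2/3)`; repeated queries do no harm, because `N`
counts rounds (`card_image_flatInterval_le`). Each interval of the partition is the name of an
expert awake in exactly the rounds that query it, and costs three terms: `log |pool|` for
aggregation (`sum_neg_log_saaMix_le`), a logarithm for online averaging (`sum_sq_sub_expert_le`),
and a bias of at most 1 (`sum_sq_sub_flatInterval_le`).

What remains is to pass from the mix losses `-log saaMix`, which involve the noisy `y`, to the error
`(ŷ - θ)²` against the truth `θ`. The factor `growth` compares the mix with `exp(-η (y - c)²)`, pays
`2η (θ - c)²` and earns `η/4 (θ - ŷ)²`. The square of the fresh noise cancels, so integrating it out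
is a Gaussian moment generating function computation; for small `η` the resulting variance term is
absorbed, and concavity of the Gaussian kernel near its centre bounds the conditional mean by 1
(`lintegral_growth_le_one`). This needs the past noise to be bounded, so the product of the factors
is killed once the noise exceeds `b`, which gives a supermartingale. It matters that `c` is fixed by
`f` and the queries, independently of the noise. Markov's inequality controls the product up to
probability `δ/2`, and a Gaussian tail bound spends the other `δ/2`. -/

namespace Aligator

/-! ### Specialist aggregation: conservation of mass and regret against one expert. -/

section SAA

variable {κ : Type*} [DecidableEq κ]

/-- The mixture `∑ w_t e^{-ℓ_t}` of the exponentiated losses over the awake experts. -/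
noncomputable def saaMix (S : Finset κ) (A : ℕ → Finset κ) (ℓ : ℕ → κ → ℝ) (t : ℕ) : ℝ :=
  ∑ k ∈ A t, saaW S A ℓ t k * Real.exp (-ℓ t k)

variable {S : Finset κ} {A : ℕ → Finset κ} {ℓ : ℕ → κ → ℝ}

lemma saaU_pos (hS : S.Nonempty) (s : ℕ) (k : κ) : 0 < saaU S A ℓ s k := by
  induction s generalizing k with
  | zero =>
    have := hS.card_pos
    simp only [saaU]
    positivity
  | succ s ih =>
    simp only [saaU]
    split_ifs with hk
    · have hne : (A (s + 1)).Nonempty := ⟨k, hk⟩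
      have h1 := Finset.sum_pos (fun j _ => ih j) hne
      have h2 := Finset.sum_pos (fun j _ => mul_pos (ih j) (Real.exp_pos (-ℓ (s + 1) j))) hne
      have := ih k
      positivity
    · exact ih k

lemma sum_awake_saaU_succ (hS : S.Nonempty) (s : ℕ) :
    ∑ k ∈ A (s + 1), saaU S A ℓ (s + 1) k = ∑ k ∈ A (s + 1), saaU S A ℓ s k := by
  rcases (A (s + 1)).eq_empty_or_nonempty with h | hne
  · simp [h]
  have h2 := Finset.sum_pos
    (fun j _ => mul_pos (saaU_pos (A := A) (ℓ := ℓ) hS s j) (Real.exp_pos (-ℓ (s + 1) j))) hne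
  calc ∑ k ∈ A (s + 1), saaU S A ℓ (s + 1) k
      = ∑ k ∈ A (s + 1), saaU S A ℓ s k * Real.exp (-ℓ (s + 1) k)
            / (∑ j ∈ A (s + 1), saaU S A ℓ s j * Real.exp (-ℓ (s + 1) j))
          * ∑ j ∈ A (s + 1), saaU S A ℓ s j := by
        refine Finset.sum_congr rfl fun k hk => ?_
        simp only [saaU, if_pos hk]
    _ = _ := by
        rw [← Finset.sum_mul, ← Finset.sum_div, div_self h2.ne', one_mul]

/-- An update only redistributes mass among the awake experts. Hence no weight ever exceeds 1, which
is why an expert starting from `1 / |S|` can gain at most a factor `|S|`. -/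
lemma sum_saaU (hS : S.Nonempty) (hA : ∀ t, A t ⊆ S) (s : ℕ) :
    ∑ k ∈ S, saaU S A ℓ s k = 1 := by
  induction s with
  | zero =>
    have := hS.card_pos
    simp only [saaU, Finset.sum_const, nsmul_eq_mul]
    field_simp
  | succ s ih =>
    rw [← ih, ← Finset.sum_sdiff (hA (s + 1)), ← Finset.sum_sdiff (hA (s + 1)),
      sum_awake_saaU_succ hS]
    congr 1
    refine Finset.sum_congr rfl fun k hk => ?_
    simp only [saaU, if_neg (Finset.mem_sdiff.mp hk).2]

lemma saaU_le_one (hS : S.Nonempty) (hA : ∀ t, A t ⊆ S) (s : ℕ) {k : κ} (hk : k ∈ S) :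
    saaU S A ℓ s k ≤ 1 := by
  rw [← sum_saaU (ℓ := ℓ) hS hA s]
  exact Finset.single_le_sum (f := saaU S A ℓ s) (fun j _ => (saaU_pos hS s j).le) hk

lemma saaW_nonneg (hS : S.Nonempty) (t : ℕ) (k : κ) : 0 ≤ saaW S A ℓ t k := by
  unfold saaW
  refine div_nonneg ?_ (Finset.sum_nonneg fun j _ => (saaU_pos hS _ j).le)
  split_ifs
  · exact (saaU_pos hS _ k).le
  · exact le_rfl

lemma sum_saaW (hS : S.Nonempty) {t : ℕ} (ht : (A t).Nonempty) :
    ∑ k ∈ A t, saaW S A ℓ t k = 1 := by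
  have h := Finset.sum_pos (fun j _ => saaU_pos (A := A) (ℓ := ℓ) hS (t - 1) j) ht
  unfold saaW
  rw [← Finset.sum_div, Finset.sum_congr rfl (fun k hk => if_pos hk), div_self h.ne']

lemma saaMix_succ (s : ℕ) :
    saaMix S A ℓ (s + 1) = (∑ j ∈ A (s + 1), saaU S A ℓ s j * Real.exp (-ℓ (s + 1) j))
      / ∑ j ∈ A (s + 1), saaU S A ℓ s j := by
  unfold saaMix saaW
  rw [Finset.sum_div]
  refine Finset.sum_congr rfl fun k hk => ?_
  rw [if_pos hk, Nat.add_sub_cancel, div_mul_eq_mul_div]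

lemma saaMix_succ_pos (hS : S.Nonempty) {s : ℕ} (hne : (A (s + 1)).Nonempty) :
    0 < saaMix S A ℓ (s + 1) := by
  rw [saaMix_succ]
  exact div_pos (Finset.sum_pos (fun j _ => mul_pos (saaU_pos hS s j) (Real.exp_pos _)) hne)
    (Finset.sum_pos (fun j _ => saaU_pos hS s j) hne)

/-- For an awake expert the renormalized update is multiplication by `e^{-ℓ}` divided by the mix,
since the awake mass before the update is the normalizer in `saaW`. In logarithms this telescopes.
-/
lemma log_saaU_succ (hS : S.Nonempty) {s : ℕ} {k : κ} (hk : k ∈ A (s + 1)) :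
    Real.log (saaU S A ℓ (s + 1) k)
      = Real.log (saaU S A ℓ s k) - ℓ (s + 1) k - Real.log (saaMix S A ℓ (s + 1)) := by
  have hne : (A (s + 1)).Nonempty := ⟨k, hk⟩
  have hm := saaMix_succ_pos (ℓ := ℓ) hS hne
  have h1 := Finset.sum_pos (fun j _ => saaU_pos (A := A) (ℓ := ℓ) hS s j) hne
  have h2 := Finset.sum_pos
    (fun j _ => mul_pos (saaU_pos (A := A) (ℓ := ℓ) hS s j) (Real.exp_pos (-ℓ (s + 1) j))) hne
  have : saaU S A ℓ (s + 1) k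
      = saaU S A ℓ s k * Real.exp (-ℓ (s + 1) k) / saaMix S A ℓ (s + 1) := by
    rw [saaMix_succ]
    simp only [saaU, if_pos hk]
    field_simp
  rw [this, Real.log_div (mul_pos (saaU_pos hS s k) (Real.exp_pos _)).ne' hm.ne',
    Real.log_mul (saaU_pos hS s k).ne' (Real.exp_pos _).ne', Real.log_exp]
  ring

/-- The regret of the aggregation algorithm against a single expert, over its awake rounds. -/
lemma sum_neg_log_saaMix_le (hS : S.Nonempty) (hA : ∀ t, A t ⊆ S) {k : κ} (hk : k ∈ S) (T : ℕ) :
    ∑ t ∈ (Finset.Icc 1 T).filter (fun t => k ∈ A t), -Real.log (saaMix S A ℓ t)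
      ≤ ∑ t ∈ (Finset.Icc 1 T).filter (fun t => k ∈ A t), ℓ t k + Real.log S.card := by
  have key : ∀ T, Real.log (saaU S A ℓ T k) = -Real.log S.card +
      ∑ t ∈ (Finset.Icc 1 T).filter (fun t => k ∈ A t), (-ℓ t k - Real.log (saaMix S A ℓ t)) := by
    intro T
    induction T with
    | zero => simp [saaU]
    | succ T ih =>
      rw [← Finset.insert_Icc_right_eq_Icc_add_one (by omega), Finset.filter_insert]
      split_ifs with h
      · rw [Finset.sum_insert (by simp), log_saaU_succ hS h, ih]
        ring
      · rw [← ih]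
        simp only [saaU, if_neg h]
  have h1 := Real.log_nonpos (saaU_pos (ℓ := ℓ) hS T k).le (saaU_le_one hS hA T hk)
  rw [key, Finset.sum_sub_distrib, Finset.sum_neg_distrib] at h1
  rw [Finset.sum_neg_distrib]
  linarith

lemma saaU_congr {ℓ' : ℕ → κ → ℝ} {s : ℕ}
    (h : ∀ t ∈ Finset.Icc 1 s, ∀ k, ℓ t k = ℓ' t k) : saaU S A ℓ s = saaU S A ℓ' s := by
  induction s with
  | zero => rfl
  | succ s ih =>
    have h0 := ih fun t ht => h t (by simp only [Finset.mem_Icc] at ht ⊢; omega)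
    funext k
    simp only [saaU, h0, h (s + 1) (by simp)]

end SAA

/-! ### Causality: forecasts and weights depend only on earlier observations. -/

section Causality

variable {n : ℕ} {η : ℝ} {i : ℕ → ℕ} {y y' : ℕ → ℝ} {t : ℕ}

lemma expert_congr (h : ∀ s ∈ Finset.Ico 1 t, y s = y' s) (I : Finset ℕ) :
    expert i y I t = expert i y' I t := by
  unfold expert
  rw [Finset.sum_congr rfl fun s hs => h s (Finset.mem_filter.mp hs).1]

lemma loss_congr (h : ∀ s ∈ Finset.Icc 1 t, y s = y' s) (ht : 1 ≤ t) (I : Finset ℕ) :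
    loss η i y t I = loss η i y' t I := by
  unfold loss
  rw [expert_congr fun s hs => h s (Finset.Ico_subset_Icc_self hs), h t (by simp [ht])]

lemma saaW_loss_congr (h : ∀ s ∈ Finset.Ico 1 t, y s = y' s) (S : Finset (Finset ℕ))
    (A : ℕ → Finset (Finset ℕ)) :
    saaW S A (loss η i y) t = saaW S A (loss η i y') t := by
  have : saaU S A (loss η i y) (t - 1) = saaU S A (loss η i y') (t - 1) := by
    refine saaU_congr fun s hs I => loss_congr (fun r hr => h r ?_) (Finset.mem_Icc.mp hs).1 I
    simp only [Finset.mem_Icc, Finset.mem_Ico] at *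
    omega
  funext I
  unfold saaW
  rw [this]

lemma forecast_congr (h : ∀ s ∈ Finset.Ico 1 t, y s = y' s) :
    forecast n η i y t = forecast n η i y' t := by
  unfold forecast
  rw [saaW_loss_congr h]
  exact Finset.sum_congr rfl fun I _ => by rw [expert_congr h]

end Causality

/-! ### Measurability of the algorithm in the observations. -/

section Measurability

variable {α : Type*} [MeasurableSpace α] {n : ℕ} {η : ℝ} {i : ℕ → ℕ} {y : α → ℕ → ℝ}

lemma measurable_expert (hy : ∀ s, Measurable fun a => y a s) (I : Finset ℕ) (t : ℕ) :
    Measurable fun a => expert i (y a) I t := by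
  unfold expert
  split_ifs
  · exact (Finset.measurable_fun_sum _ fun s _ => hy s).div_const _
  · exact measurable_const

lemma measurable_loss (hy : ∀ s, Measurable fun a => y a s) (t : ℕ) (I : Finset ℕ) :
    Measurable fun a => loss η i (y a) t I :=
  (((hy t).sub (measurable_expert hy I t)).pow_const 2).const_mul η

lemma measurable_saaU {κ : Type*} [DecidableEq κ] {S : Finset κ} {A : ℕ → Finset κ}
    {ℓ : α → ℕ → κ → ℝ} (hℓ : ∀ t k, Measurable fun a => ℓ a t k) (s : ℕ) (k : κ) :
    Measurable fun a => saaU S A (ℓ a) s k := by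
  induction s generalizing k with
  | zero => exact measurable_const
  | succ s ih =>
    simp only [saaU]
    have h1 : ∀ j, Measurable fun a => saaU S A (ℓ a) s j * Real.exp (-ℓ a (s + 1) j) :=
      fun j => (ih j).mul (hℓ _ j).neg.exp
    split_ifs
    · exact ((h1 k).div (Finset.measurable_fun_sum _ fun j _ => h1 j)).mul
        (Finset.measurable_fun_sum _ fun j _ => ih j)
    · exact ih k

lemma measurable_saaW {κ : Type*} [DecidableEq κ] {S : Finset κ} {A : ℕ → Finset κ}
    {ℓ : α → ℕ → κ → ℝ} (hℓ : ∀ t k, Measurable fun a => ℓ a t k) (t : ℕ) (k : κ) :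
    Measurable fun a => saaW S A (ℓ a) t k := by
  unfold saaW
  refine Measurable.div ?_ (Finset.measurable_fun_sum _ fun j _ => measurable_saaU hℓ _ j)
  split_ifs
  · exact measurable_saaU hℓ _ k
  · exact measurable_const

lemma measurable_forecast (hy : ∀ s, Measurable fun a => y a s) (t : ℕ) :
    Measurable fun a => forecast n η i (y a) t :=
  Finset.measurable_fun_sum _ fun I _ =>
    (measurable_saaW (fun s J => measurable_loss hy s J) t I).mul (measurable_expert hy I t)

lemma measurable_saaMix {κ : Type*} [DecidableEq κ] {S : Finset κ} {A : ℕ → Finset κ}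
    {ℓ : α → ℕ → κ → ℝ} (hℓ : ∀ t k, Measurable fun a => ℓ a t k) (t : ℕ) :
    Measurable fun a => saaMix S A (ℓ a) t :=
  Finset.measurable_fun_sum _ fun k _ => (measurable_saaW hℓ t k).mul (hℓ t k).neg.exp

end Measurability

/-! ### Regret of the running mean against a constant. -/

section OnlineAveraging

variable {i : ℕ → ℕ} {y : ℕ → ℝ} {I : Finset ℕ}

lemma abs_expert_le {t : ℕ} {M : ℝ} (hM : 0 ≤ M) (hy : ∀ s ∈ Finset.Ico 1 t, |y s| ≤ M) :
    |expert i y I t| ≤ M := by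
  unfold expert
  split_ifs with h
  · have h' : (0 : ℝ) < (((Finset.Ico 1 t).filter (fun s => i s ∈ I)).card : ℝ) := by
      exact_mod_cast h
    rw [abs_div, abs_of_pos h', div_le_iff₀ h']
    calc |∑ s ∈ (Finset.Ico 1 t).filter (fun s => i s ∈ I), y s|
        ≤ ∑ s ∈ (Finset.Ico 1 t).filter (fun s => i s ∈ I), |y s| :=
          Finset.abs_sum_le_sum_abs _ _
      _ ≤ ∑ s ∈ (Finset.Ico 1 t).filter (fun s => i s ∈ I), M :=
          Finset.sum_le_sum fun s hs => hy s (Finset.mem_filter.mp hs).1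
      _ = M * _ := by rw [Finset.sum_const, nsmul_eq_mul, mul_comm]
  · simpa using hM

lemma card_mul_expert_succ (T : ℕ) :
    (((Finset.Icc 1 T).filter (fun s => i s ∈ I)).card : ℝ) * expert i y I (T + 1)
      = ∑ s ∈ (Finset.Icc 1 T).filter (fun s => i s ∈ I), y s := by
  have hI : Finset.Ico 1 (T + 1) = Finset.Icc 1 T := by ext; simp
  unfold expert
  rw [hI]
  split_ifs with h
  · field_simp
  · have : (Finset.Icc 1 T).filter (fun s => i s ∈ I) = ∅ := by
      rw [← Finset.card_eq_zero]; omega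
    simp [this]

/-- The online mean against a constant, with the gap at the final mean kept for the induction. -/
lemma sum_sq_sub_expert_add_le {M : ℝ} (hM : 0 ≤ M) (c : ℝ) (T : ℕ)
    (hy : ∀ s ∈ Finset.Icc 1 T, |y s| ≤ M) :
    ∑ t ∈ (Finset.Icc 1 T).filter (fun s => i s ∈ I), (y t - expert i y I t) ^ 2
        + ((Finset.Icc 1 T).filter (fun s => i s ∈ I)).card * (expert i y I (T + 1) - c) ^ 2
      ≤ ∑ t ∈ (Finset.Icc 1 T).filter (fun s => i s ∈ I), (y t - c) ^ 2
        + 4 * M ^ 2 * (harmonic ((Finset.Icc 1 T).filter (fun s => i s ∈ I)).card : ℝ) := by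
  induction T with
  | zero => simp
  | succ T ih =>
    have hy' : ∀ s ∈ Finset.Icc 1 T, |y s| ≤ M := fun s hs =>
      hy s (by simp only [Finset.mem_Icc] at hs ⊢; omega)
    have ih := ih hy'
    have hm0 := card_mul_expert_succ (i := i) (y := y) (I := I) T
    have hm1 := card_mul_expert_succ (i := i) (y := y) (I := I) (T + 1)
    have hins : Finset.Icc 1 (T + 1) = insert (T + 1) (Finset.Icc 1 T) :=
      (Finset.insert_Icc_right_eq_Icc_add_one (by omega)).symm
    by_cases h : i (T + 1) ∈ I
    · have hf : (Finset.Icc 1 (T + 1)).filter (fun s => i s ∈ I)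
          = insert (T + 1) ((Finset.Icc 1 T).filter (fun s => i s ∈ I)) := by
        rw [hins, Finset.filter_insert, if_pos h]
      have hn : T + 1 ∉ (Finset.Icc 1 T).filter (fun s => i s ∈ I) := by simp
      rw [hf, Finset.sum_insert hn, Finset.card_insert_of_notMem hn] at hm1
      rw [hf, Finset.sum_insert hn, Finset.sum_insert hn, Finset.card_insert_of_notMem hn,
        harmonic_succ]
      have ha : |expert i y I (T + 1)| ≤ M := abs_expert_le hM fun s hs =>
        hy' s (by simp only [Finset.mem_Icc, Finset.mem_Ico] at hs ⊢; omega)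
      have hyT := hy (T + 1) (by simp)
      rw [← hm0] at hm1
      push_cast at hm1 ⊢
      set N : ℝ := (((Finset.Icc 1 T).filter (fun s => i s ∈ I)).card : ℝ)
      have hN : 0 ≤ N := Nat.cast_nonneg _
      set a := expert i y I (T + 1)
      set a' := expert i y I (T + 1 + 1)
      set z := y (T + 1)
      have hN1 : (0 : ℝ) < N + 1 := by linarith
      have ha' : a' = (z + N * a) / (N + 1) := by
        field_simp
        linarith
      -- Exact bias–variance identity for one more observation. The excess `(z - a)² / (N + 1)` is
      -- what sums to the harmonic number; for `N = 0` the default value `a = 0` still satisfies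
      -- `|a| ≤ M`, so the first visit needs no separate treatment.
      have hid : (z - a) ^ 2 + (N + 1) * (a' - c) ^ 2
          = (z - c) ^ 2 + N * (a - c) ^ 2 + (z - a) ^ 2 * (N + 1)⁻¹ := by
        rw [ha']
        field_simp
        ring
      have hza : (z - a) ^ 2 ≤ 4 * M ^ 2 := by
        rw [abs_le] at ha hyT
        nlinarith
      have := mul_le_mul_of_nonneg_right hza (inv_nonneg.mpr hN1.le)
      linarith
    · have hf : (Finset.Icc 1 (T + 1)).filter (fun s => i s ∈ I)
          = (Finset.Icc 1 T).filter (fun s => i s ∈ I) := by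
        rw [hins, Finset.filter_insert, if_neg h]
      have he : ((((Finset.Icc 1 T).filter (fun s => i s ∈ I)).card : ℝ)
            * (expert i y I (T + 1 + 1) - c) ^ 2)
          = (((Finset.Icc 1 T).filter (fun s => i s ∈ I)).card : ℝ)
            * (expert i y I (T + 1) - c) ^ 2 := by
        rw [hf, ← hm0] at hm1
        rcases mul_eq_mul_left_iff.mp hm1 with h' | h'
        · rw [h']
        · rw [h']; ring
      rw [hf, he]
      exact ih

lemma sum_sq_sub_expert_le {M : ℝ} (hM : 0 ≤ M) (c : ℝ) (T : ℕ)
    (hy : ∀ s ∈ Finset.Icc 1 T, |y s| ≤ M) :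
    ∑ t ∈ (Finset.Icc 1 T).filter (fun s => i s ∈ I), (y t - expert i y I t) ^ 2
      ≤ ∑ t ∈ (Finset.Icc 1 T).filter (fun s => i s ∈ I), (y t - c) ^ 2
        + 4 * M ^ 2 * (1 + Real.log T) := by
  have h := sum_sq_sub_expert_add_le (i := i) (I := I) hM c T hy
  set N := ((Finset.Icc 1 T).filter (fun s => i s ∈ I)).card with hN
  have hNT : N ≤ T := (Finset.card_filter_le _ _).trans (by simp)
  have hlog : Real.log N ≤ Real.log T := by
    rcases N.eq_zero_or_pos with h0 | h0
    · rw [h0]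
      simpa using Real.log_natCast_nonneg T
    · exact Real.log_le_log (by exact_mod_cast h0) (by exact_mod_cast hNT)
  have h1 := harmonic_le_one_add_log N
  have h2 : 4 * M ^ 2 * (harmonic N : ℝ) ≤ 4 * M ^ 2 * (1 + Real.log T) :=
    mul_le_mul_of_nonneg_left (by linarith) (by positivity)
  have h3 : 0 ≤ (N : ℝ) * (expert i y I (T + 1) - c) ^ 2 := by positivity
  linarith

end OnlineAveraging

/-! ### Dyadic intervals and the partition into maximal flat ones. -/

section Dyadic

/-- The dyadic interval `[q·2ᵏ, (q+1)·2ᵏ - 1]`. -/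
def dyadic (k q : ℕ) : Finset ℕ := Finset.Icc (q * 2 ^ k) ((q + 1) * 2 ^ k - 1)

lemma mem_dyadic {k q j : ℕ} : j ∈ dyadic k q ↔ j / 2 ^ k = q := by
  have h2 : 0 < 2 ^ k := by positivity
  rw [dyadic, Finset.mem_Icc, Nat.div_eq_iff h2]
  have : 1 ≤ (q + 1) * 2 ^ k := Nat.mul_pos (by omega) h2
  rw [add_mul] at this ⊢
  omega

lemma dyadic_subset_iff {k q n : ℕ} :
    dyadic k q ⊆ Finset.Icc 1 n ↔ 1 ≤ q ∧ (q + 1) * 2 ^ k ≤ n + 1 := by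
  have h2 : 0 < 2 ^ k := by positivity
  have h3 : (q + 1) * 2 ^ k = q * 2 ^ k + 2 ^ k := by ring
  rw [dyadic, Finset.Icc_subset_Icc_iff (by omega)]
  have : 1 ≤ q * 2 ^ k ↔ 1 ≤ q := by
    constructor
    · intro h
      by_contra h0
      have : q = 0 := by omega
      simp [this] at h
    · intro h
      exact Nat.mul_pos h h2
  omega

lemma dyadic_mem_pool {k q n : ℕ} (h : dyadic k q ⊆ Finset.Icc 1 n) : dyadic k q ∈ pool n := by
  classical
  rw [pool, Finset.mem_filter, Finset.mem_powerset]
  exact ⟨h, k, q, (dyadic_subset_iff.mp h).1, rfl⟩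

lemma le_log_of_dyadic_subset {k q n : ℕ} (h : dyadic k q ⊆ Finset.Icc 1 n) :
    k ≤ Nat.log 2 n := by
  obtain ⟨h1, h2⟩ := dyadic_subset_iff.mp h
  have h3 : 2 ^ k + 2 ^ k ≤ (q + 1) * 2 ^ k := by nlinarith [Nat.two_pow_pos k]
  have h4 := Nat.one_le_two_pow (n := k)
  exact Nat.le_log_of_pow_le (by norm_num) (by omega)

/-- A crude count by pairs of endpoints suffices, since the size of the pool enters only through its
logarithm. -/
lemma card_pool_le (n : ℕ) : (pool n).card ≤ n ^ 2 := by
  classical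
  have : pool n ⊆ (Finset.Icc 1 n ×ˢ Finset.Icc 1 n).image (fun p => Finset.Icc p.1 p.2) := by
    intro I hI
    rw [pool, Finset.mem_filter, Finset.mem_powerset] at hI
    obtain ⟨hs, k, q, hq, rfl⟩ := hI
    have h2 : 0 < 2 ^ k := by positivity
    have h3 : (q + 1) * 2 ^ k = q * 2 ^ k + 2 ^ k := by ring
    rw [Finset.Icc_subset_Icc_iff (by omega)] at hs
    refine Finset.mem_image.mpr ⟨(q * 2 ^ k, (q + 1) * 2 ^ k - 1), ?_, rfl⟩
    simp only [Finset.mem_product, Finset.mem_Icc]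
    omega
  refine (Finset.card_le_card this).trans (Finset.card_image_le.trans ?_)
  simp [sq]

lemma pool_nonempty {n : ℕ} (hn : 1 ≤ n) : (pool n).Nonempty :=
  ⟨dyadic 0 1, dyadic_mem_pool (dyadic_subset_iff.mpr (by simp; omega))⟩

lemma awake_nonempty {n j : ℕ} (hj : j ∈ Finset.Icc 1 n) : (awake n j).Nonempty := by
  rw [Finset.mem_Icc] at hj
  refine ⟨dyadic 0 j, Finset.mem_filter.mpr ⟨dyadic_mem_pool (dyadic_subset_iff.mpr ?_), ?_⟩⟩
  · simp; omega
  · simp [mem_dyadic]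

/-- The variation of the sequence `g` inside a dyadic interval. -/
noncomputable def variation (g : ℕ → ℝ) (k q : ℕ) : ℝ :=
  ∑ l ∈ Finset.Icc (q * 2 ^ k + 1) ((q + 1) * 2 ^ k - 1), |g l - g (l - 1)|

/-- The number of rounds up to `n` in which an index of a dyadic interval is queried. -/
def visits (n : ℕ) (i : ℕ → ℕ) (k q : ℕ) : ℕ :=
  ((Finset.Icc 1 n).filter (fun t => i t / 2 ^ k = q)).card

variable {n : ℕ} {i : ℕ → ℕ} {g : ℕ → ℝ} {C : ℝ}

lemma variation_nonneg (g : ℕ → ℝ) (k q : ℕ) : 0 ≤ variation g k q :=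
  Finset.sum_nonneg fun _ _ => abs_nonneg _

lemma abs_sub_le_sum_abs_sub (g : ℕ → ℝ) (a d : ℕ) :
    |g (a + d) - g a| ≤ ∑ l ∈ Finset.Icc (a + 1) (a + d), |g l - g (l - 1)| := by
  induction d with
  | zero => simp
  | succ d ih =>
    rw [← add_assoc, ← Finset.insert_Icc_right_eq_Icc_add_one (by omega),
      Finset.sum_insert (by simp), Nat.add_sub_cancel]
    have := abs_sub_le (g (a + d + 1)) (g (a + d)) (g a)
    linarith

lemma abs_sub_le_variation {k q j : ℕ} (hj : j ∈ dyadic k q) :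
    |g j - g (q * 2 ^ k)| ≤ variation g k q := by
  rw [dyadic, Finset.mem_Icc] at hj
  obtain ⟨d, rfl⟩ := Nat.exists_eq_add_of_le hj.1
  refine (abs_sub_le_sum_abs_sub g _ d).trans ?_
  exact Finset.sum_le_sum_of_subset_of_nonneg (Finset.Icc_subset_Icc_right hj.2)
    fun _ _ _ => abs_nonneg _

lemma sum_variation_le (hC : ∑ j ∈ Finset.Icc 2 n, |g j - g (j - 1)| ≤ C) (k : ℕ) (Q : Finset ℕ)
    (hQ : ∀ q ∈ Q, dyadic k q ⊆ Finset.Icc 1 n) : ∑ q ∈ Q, variation g k q ≤ C := by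
  refine le_trans ?_ hC
  calc ∑ q ∈ Q, variation g k q
      ≤ ∑ q ∈ Q, ∑ l ∈ (Finset.Icc 2 n).filter (fun l => l / 2 ^ k = q), |g l - g (l - 1)| := by
        refine Finset.sum_le_sum fun q hq => ?_
        refine Finset.sum_le_sum_of_subset_of_nonneg (fun l hl => ?_) fun _ _ _ => abs_nonneg _
        obtain ⟨h1, h2⟩ := dyadic_subset_iff.mp (hQ q hq)
        have h3 : 1 ≤ q * 2 ^ k := Nat.mul_pos h1 (by positivity)
        rw [Finset.mem_Icc] at hl
        rw [Finset.mem_filter, Finset.mem_Icc, ← mem_dyadic, dyadic, Finset.mem_Icc]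
        omega
    _ ≤ _ := Finset.sum_fiberwise_le_sum_of_sum_fiber_nonneg
        fun q _ => Finset.sum_nonneg fun _ _ => abs_nonneg _

lemma sum_visits_le (n : ℕ) (i : ℕ → ℕ) (k : ℕ) (Q : Finset ℕ) :
    ∑ q ∈ Q, visits n i k q ≤ n := by
  have := Finset.sum_fiberwise_le_sum_of_sum_fiber_nonneg (s := Finset.Icc 1 n) (t := Q)
    (g := fun t => i t / 2 ^ k) (f := fun _ => (1 : ℤ)) (by intros; positivity)
  simp only [Finset.sum_const, Nat.card_Icc, Nat.add_sub_cancel, nsmul_eq_mul, mul_one] at this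
  unfold visits
  exact_mod_cast this

/-- At each scale only few dyadic intervals have a large variation relative to their visits. -/
lemma card_le_of_one_le_variation (hC : ∑ j ∈ Finset.Icc 2 n, |g j - g (j - 1)| ≤ C) (k : ℕ)
    (Q : Finset ℕ) (hQ : ∀ q ∈ Q, dyadic k q ⊆ Finset.Icc 1 n)
    (h : ∀ q ∈ Q, 1 ≤ variation g k q ^ 2 * visits n i k q) :
    (Q.card : ℝ) ≤ (n : ℝ) ^ (1 / 3 : ℝ) * C ^ (2 / 3 : ℝ) := by
  have hV := fun q => variation_nonneg g k q
  have hN : ∀ q, (0 : ℝ) ≤ visits n i k q := fun q => Nat.cast_nonneg _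
  -- The cube root of `1 ≤ V² N` is `1 ≤ V^(2/3) N^(1/3)`; the exponents `3/2` and `3` turn the two
  -- factors back into `V` and `N`, whose sums over one scale are at most `C` and `n`.
  have hpq : (3 / 2 : ℝ).HolderConjugate 3 := by
    rw [Real.holderConjugate_iff]; norm_num
  have hold := Real.inner_le_Lp_mul_Lq_of_nonneg Q hpq
    (f := fun q => variation g k q ^ (2 / 3 : ℝ)) (g := fun q => (visits n i k q : ℝ) ^ (1 / 3 : ℝ))
    (fun q _ => Real.rpow_nonneg (hV q) _) (fun q _ => Real.rpow_nonneg (hN q) _)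
  have e1 : ∀ q, (variation g k q ^ (2 / 3 : ℝ)) ^ (3 / 2 : ℝ) = variation g k q := fun q => by
    rw [← Real.rpow_mul (hV q)]; norm_num
  have e2 : ∀ q, ((visits n i k q : ℝ) ^ (1 / 3 : ℝ)) ^ (3 : ℝ) = visits n i k q := fun q => by
    rw [← Real.rpow_mul (hN q)]; norm_num
  simp only [e1, e2] at hold
  calc (Q.card : ℝ) = ∑ q ∈ Q, (1 : ℝ) := by simp
    _ ≤ ∑ q ∈ Q, variation g k q ^ (2 / 3 : ℝ) * (visits n i k q : ℝ) ^ (1 / 3 : ℝ) := by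
        refine Finset.sum_le_sum fun q hq => ?_
        have := Real.one_le_rpow (h q hq) (by norm_num : (0 : ℝ) ≤ 1 / 3)
        rw [Real.mul_rpow (by positivity) (hN q), ← Real.rpow_natCast, ← Real.rpow_mul (hV q)]
          at this
        norm_num at this ⊢
        exact this
    _ ≤ _ := hold
    _ ≤ C ^ (2 / 3 : ℝ) * (n : ℝ) ^ (1 / 3 : ℝ) := by
        have s1 := sum_variation_le hC k Q hQ
        have s2 : ∑ q ∈ Q, (visits n i k q : ℝ) ≤ n := by exact_mod_cast sum_visits_le n i k Q
        have s0 : 0 ≤ ∑ q ∈ Q, variation g k q := Finset.sum_nonneg fun q _ => hV q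
        have s0' : (0 : ℝ) ≤ ∑ q ∈ Q, (visits n i k q : ℝ) := Finset.sum_nonneg fun q _ => hN q
        norm_num
        gcongr
        exact Real.rpow_nonneg (s0.trans s1) _
    _ = _ := mul_comm _ _

/-- A dyadic interval inside `[1, n]` on which the squared variation, summed over the visits,
is at most one. -/
def IsFlat (n : ℕ) (i : ℕ → ℕ) (g : ℕ → ℝ) (k q : ℕ) : Prop :=
  dyadic k q ⊆ Finset.Icc 1 n ∧ variation g k q ^ 2 * visits n i k q ≤ 1

lemma isFlat_zero {j : ℕ} (hj : j ∈ Finset.Icc 1 n) : IsFlat n i g 0 j := by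
  rw [Finset.mem_Icc] at hj
  refine ⟨dyadic_subset_iff.mpr (by simp; omega), ?_⟩
  simp [variation]

open Classical in
/-- The scale of the largest flat dyadic interval around `j`. -/
noncomputable def flatLevel (n : ℕ) (i : ℕ → ℕ) (g : ℕ → ℝ) (j : ℕ) : ℕ :=
  Nat.findGreatest (fun k => IsFlat n i g k (j / 2 ^ k)) (Nat.log 2 n)

/-- The largest flat dyadic interval around `j`. -/
noncomputable def flatInterval (n : ℕ) (i : ℕ → ℕ) (g : ℕ → ℝ) (j : ℕ) : Finset ℕ :=
  dyadic (flatLevel n i g j) (j / 2 ^ flatLevel n i g j)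

lemma isFlat_flatLevel {j : ℕ} (hj : j ∈ Finset.Icc 1 n) :
    IsFlat n i g (flatLevel n i g j) (j / 2 ^ flatLevel n i g j) := by
  classical
  exact Nat.findGreatest_spec (P := fun k => IsFlat n i g k (j / 2 ^ k)) (Nat.zero_le _)
    (by simpa using isFlat_zero hj)

lemma le_flatLevel {j k : ℕ} (h : IsFlat n i g k (j / 2 ^ k)) : k ≤ flatLevel n i g j := by
  classical
  exact Nat.le_findGreatest (le_log_of_dyadic_subset h.1) h

lemma mem_flatInterval (j : ℕ) : j ∈ flatInterval n i g j := mem_dyadic.mpr rfl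

lemma flatInterval_mem_awake {j : ℕ} (hj : j ∈ Finset.Icc 1 n) :
    flatInterval n i g j ∈ awake n j :=
  Finset.mem_filter.mpr ⟨dyadic_mem_pool (isFlat_flatLevel hj).1, mem_flatInterval j⟩

/-- Dyadic intervals are nested or disjoint. The interval of `j` is a flat candidate for `j'`, so
the level of `j'` is at least as large; at that level `j` and `j'` still share an interval, so
maximality for `j` gives equality. -/
lemma flatInterval_eq_of_mem {j j' : ℕ} (hj : j ∈ Finset.Icc 1 n) (hj' : j' ∈ Finset.Icc 1 n)
    (h : j' ∈ flatInterval n i g j) : flatInterval n i g j' = flatInterval n i g j := by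
  rw [flatInterval, mem_dyadic] at h
  have h1 : flatLevel n i g j ≤ flatLevel n i g j' := by
    apply le_flatLevel
    rw [h]
    exact isFlat_flatLevel hj
  obtain ⟨d, hd⟩ := Nat.exists_eq_add_of_le h1
  have h2 : j' / 2 ^ flatLevel n i g j' = j / 2 ^ flatLevel n i g j' := by
    rw [hd, pow_add, ← Nat.div_div_eq_div_mul, ← Nat.div_div_eq_div_mul, h]
  have h3 : flatLevel n i g j' ≤ flatLevel n i g j := by
    apply le_flatLevel
    rw [← h2]
    exact isFlat_flatLevel hj'
  rw [flatInterval, flatInterval, h2, le_antisymm h3 h1]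

lemma sum_sq_sub_flatInterval_le {j : ℕ} (hj : j ∈ Finset.Icc 1 n) :
    ∑ t ∈ (Finset.Icc 1 n).filter (fun t => i t ∈ flatInterval n i g j),
      (g (i t) - g (sInf (flatInterval n i g j : Set ℕ))) ^ 2 ≤ 1 := by
  have hflat := isFlat_flatLevel (i := i) (g := g) hj
  rw [flatInterval]
  set k := flatLevel n i g j
  set q := j / 2 ^ k
  have h2 : 0 < 2 ^ k := by positivity
  have h3 : (q + 1) * 2 ^ k = q * 2 ^ k + 2 ^ k := by ring
  have hinf : sInf (dyadic k q : Set ℕ) = q * 2 ^ k := by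
    rw [dyadic, Finset.coe_Icc]
    exact csInf_Icc (by omega)
  rw [hinf]
  refine le_trans ?_ hflat.2
  calc ∑ t ∈ (Finset.Icc 1 n).filter (fun t => i t ∈ dyadic k q), (g (i t) - g (q * 2 ^ k)) ^ 2
      ≤ ∑ t ∈ (Finset.Icc 1 n).filter (fun t => i t ∈ dyadic k q), variation g k q ^ 2 := by
        refine Finset.sum_le_sum fun t ht => ?_
        rw [← sq_abs]
        exact pow_le_pow_left₀ (abs_nonneg _) (abs_sub_le_variation (Finset.mem_filter.mp ht).2) 2
    _ = variation g k q ^ 2 * visits n i k q := by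
        simp only [mem_dyadic, visits, Finset.sum_const, nsmul_eq_mul, mul_comm]

/-- A parent inside `[1, n]` must violate the variation bound, so Hölder counts the parents, each
with two children. A parent can leave `[1, n]` only on the left, for `q = 1` (its parent has index
0), or on the right, for the last interval of scale `k` that fits: these are the two extra
intervals. -/
lemma card_not_isFlat_parent_le (hC : ∑ j ∈ Finset.Icc 2 n, |g j - g (j - 1)| ≤ C) (k : ℕ)
    (Q : Finset ℕ) (hQ : ∀ q ∈ Q, dyadic k q ⊆ Finset.Icc 1 n)
    (hQ' : ∀ q ∈ Q, ¬ IsFlat n i g (k + 1) (q / 2)) :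
    (Q.card : ℝ) ≤ 2 + 2 * ((n : ℝ) ^ (1 / 3 : ℝ) * C ^ (2 / 3 : ℝ)) := by
  classical
  set R := (Q.image (fun q => q / 2)).filter (fun r => dyadic (k + 1) r ⊆ Finset.Icc 1 n) with hR
  have hRc : (R.card : ℝ) ≤ (n : ℝ) ^ (1 / 3 : ℝ) * C ^ (2 / 3 : ℝ) := by
    refine card_le_of_one_le_variation (i := i) hC (k + 1) R
      (fun r hr => (Finset.mem_filter.mp hr).2) fun r hr => ?_
    obtain ⟨hr1, hr2⟩ := Finset.mem_filter.mp hr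
    obtain ⟨q, hq, rfl⟩ := Finset.mem_image.mp hr1
    by_contra hlt
    exact hQ' q hq ⟨hr2, (not_le.mp hlt).le⟩
  have hsub : Q ⊆ {1, (n + 1) / 2 ^ k - 1} ∪
      (R.image (fun r => 2 * r) ∪ R.image (fun r => 2 * r + 1)) := by
    intro q hq
    obtain ⟨h1, h2⟩ := dyadic_subset_iff.mp (hQ q hq)
    by_cases hr : dyadic (k + 1) (q / 2) ⊆ Finset.Icc 1 n
    · have hqR : q / 2 ∈ R := Finset.mem_filter.mpr ⟨Finset.mem_image_of_mem _ hq, hr⟩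
      refine Finset.mem_union_right _ (Finset.mem_union.mpr ?_)
      rcases Nat.even_or_odd' q with ⟨r, hr | hr⟩
      · exact Or.inl (Finset.mem_image.mpr ⟨q / 2, hqR, by omega⟩)
      · exact Or.inr (Finset.mem_image.mpr ⟨q / 2, hqR, by omega⟩)
    · refine Finset.mem_union_left _ ?_
      rw [Finset.mem_insert, Finset.mem_singleton]
      by_cases hq1 : q = 1
      · exact Or.inl hq1
      right
      have hr' : n + 1 < (q / 2 + 1) * 2 * 2 ^ k := by
        by_contra hcon
        refine hr (dyadic_subset_iff.mpr ⟨by omega, ?_⟩)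
        rw [pow_succ, mul_comm (2 ^ k) 2, ← mul_assoc]
        omega
      have hle : n + 1 < (q + 1 + 1) * 2 ^ k :=
        hr'.trans_le (Nat.mul_le_mul_right _ (by omega))
      have : (n + 1) / 2 ^ k = q + 1 := Nat.div_eq_of_lt_le h2 hle
      omega
  have hcard : Q.card ≤ 2 + 2 * R.card := by
    refine (Finset.card_le_card hsub).trans ((Finset.card_union_le _ _).trans ?_)
    have a1 := Finset.card_le_two (a := 1) (b := (n + 1) / 2 ^ k - 1)
    have a2 := Finset.card_union_le (R.image (fun r => 2 * r)) (R.image (fun r => 2 * r + 1))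
    have a3 := Finset.card_image_le (s := R) (f := fun r => 2 * r)
    have a4 := Finset.card_image_le (s := R) (f := fun r => 2 * r + 1)
    omega
  have : (Q.card : ℝ) ≤ 2 + 2 * R.card := by exact_mod_cast hcard
  linarith

/-- The maximal flat intervals form a small partition. -/
lemma card_image_flatInterval_le (hC : ∑ j ∈ Finset.Icc 2 n, |g j - g (j - 1)| ≤ C) :
    (((Finset.Icc 1 n).image (flatInterval n i g)).card : ℝ)
      ≤ (Nat.log 2 n + 1) * (2 + 2 * ((n : ℝ) ^ (1 / 3 : ℝ) * C ^ (2 / 3 : ℝ))) := by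
  classical
  set Q : ℕ → Finset ℕ := fun k => ((Finset.Icc 1 n).image (fun j => j / 2 ^ k)).filter
    (fun q => dyadic k q ⊆ Finset.Icc 1 n ∧ ¬ IsFlat n i g (k + 1) (q / 2)) with hQ
  have hsub : (Finset.Icc 1 n).image (flatInterval n i g)
      ⊆ (Finset.range (Nat.log 2 n + 1)).biUnion (fun k => (Q k).image (dyadic k)) := by
    intro I hI
    obtain ⟨j, hj, rfl⟩ := Finset.mem_image.mp hI
    have hfl := isFlat_flatLevel (i := i) (g := g) hj
    refine Finset.mem_biUnion.mpr ⟨flatLevel n i g j, ?_, Finset.mem_image.mpr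
      ⟨j / 2 ^ flatLevel n i g j, Finset.mem_filter.mpr ⟨Finset.mem_image_of_mem _ hj, hfl.1, ?_⟩,
        rfl⟩⟩
    · exact Finset.mem_range.mpr (Nat.lt_succ_of_le (le_log_of_dyadic_subset hfl.1))
    · intro hbad
      rw [Nat.div_div_eq_div_mul, ← pow_succ] at hbad
      have := le_flatLevel hbad
      omega
  have h1 : ((Finset.Icc 1 n).image (flatInterval n i g)).card
      ≤ ∑ k ∈ Finset.range (Nat.log 2 n + 1), (Q k).card :=
    (Finset.card_le_card hsub).trans (Finset.card_biUnion_le.trans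
      (Finset.sum_le_sum fun k _ => Finset.card_image_le))
  calc (((Finset.Icc 1 n).image (flatInterval n i g)).card : ℝ)
      ≤ ∑ k ∈ Finset.range (Nat.log 2 n + 1), ((Q k).card : ℝ) := by exact_mod_cast h1
    _ ≤ ∑ k ∈ Finset.range (Nat.log 2 n + 1),
          (2 + 2 * ((n : ℝ) ^ (1 / 3 : ℝ) * C ^ (2 / 3 : ℝ))) :=
        Finset.sum_le_sum fun k _ => card_not_isFlat_parent_le hC k (Q k)
          (fun q hq => (Finset.mem_filter.mp hq).2.1) fun q hq => (Finset.mem_filter.mp hq).2.2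
    _ = _ := by
        rw [Finset.sum_const, Finset.card_range, nsmul_eq_mul]
        push_cast
        ring

end Dyadic

/-! ### The exponential supermartingale. -/

/-- Concavity of the Gaussian kernel near its centre, in a mixture form. -/
lemma sum_mul_exp_neg_sq_le {κ : Type*} (s : Finset κ) (w a : κ → ℝ) (hw : ∀ k ∈ s, 0 ≤ w k)
    (hsum : ∑ k ∈ s, w k = 1) {r θ D : ℝ} (hr : 0 ≤ r) (ha : ∀ k ∈ s, |θ - a k| ≤ D)
    (hD : 4 * (r * D ^ 2) ≤ 1) :
    ∑ k ∈ s, w k * Real.exp (-(r * (θ - a k) ^ 2))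
      ≤ Real.exp (-(r * (θ - ∑ k ∈ s, w k * a k) ^ 2)) := by
  set v := θ - ∑ k ∈ s, w k * a k with hv
  have hv' : v = ∑ k ∈ s, w k * (θ - a k) := by
    simp only [mul_sub, Finset.sum_sub_distrib, ← Finset.sum_mul, hsum, hv, one_mul]
  have hvD : |v| ≤ D := by
    rw [hv']
    calc |∑ k ∈ s, w k * (θ - a k)| ≤ ∑ k ∈ s, |w k * (θ - a k)| := Finset.abs_sum_le_sum_abs _ _
      _ ≤ ∑ k ∈ s, w k * D := by
          refine Finset.sum_le_sum fun k hk => ?_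
          rw [abs_mul, abs_of_nonneg (hw k hk)]
          exact mul_le_mul_of_nonneg_left (ha k hk) (hw k hk)
      _ = D := by rw [← Finset.sum_mul, hsum, one_mul]
  have hv2 : v ^ 2 ≤ D ^ 2 := sq_le_sq.mpr (hvD.trans (le_abs_self D))
  -- A tangent-line bound at the mean deviation `v`: in `exp z ≤ 1 + z + z²` with `z = r v² - r u²`,
  -- the bound on `D` gives `z² ≤ r (u - v)²`, which cancels the `u²` in `z`. The rest is affine in
  -- `u`, and its linear part averages to zero.
  have hterm : ∀ k ∈ s, w k * Real.exp (-(r * (θ - a k) ^ 2))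
      ≤ Real.exp (-(r * v ^ 2)) * (w k + 2 * r * v * (w k * v - w k * (θ - a k))) := by
    intro k hk
    set u := θ - a k
    have hu2 : u ^ 2 ≤ D ^ 2 := sq_le_sq.mpr ((ha k hk).trans (le_abs_self D))
    have hz : |r * v ^ 2 - r * u ^ 2| ≤ 1 := by
      have h1 := mul_le_mul_of_nonneg_left hu2 hr
      have h2 := mul_le_mul_of_nonneg_left hv2 hr
      have h3 : 0 ≤ r * u ^ 2 := by positivity
      have h4 : 0 ≤ r * v ^ 2 := by positivity
      rw [abs_le]
      constructor <;> linarith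
    have he := (abs_le.mp (Real.abs_exp_sub_one_sub_id_le hz)).2
    have huv : r * (u + v) ^ 2 ≤ 1 := by
      have : (u + v) ^ 2 ≤ 4 * D ^ 2 := by nlinarith [sq_nonneg (u - v)]
      nlinarith [mul_le_mul_of_nonneg_left this hr]
    have hq : (r * v ^ 2 - r * u ^ 2) ^ 2 ≤ r * (u - v) ^ 2 := by
      calc (r * v ^ 2 - r * u ^ 2) ^ 2 = (r * (u - v) ^ 2) * (r * (u + v) ^ 2) := by ring
        _ ≤ (r * (u - v) ^ 2) * 1 := mul_le_mul_of_nonneg_left huv (by positivity)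
        _ = _ := mul_one _
    have hexp : Real.exp (r * v ^ 2 - r * u ^ 2) ≤ 1 + 2 * r * v * (v - u) := by
      have : r * v ^ 2 - r * u ^ 2 + r * (u - v) ^ 2 = 2 * r * v * (v - u) := by ring
      linarith
    calc w k * Real.exp (-(r * u ^ 2))
        = Real.exp (-(r * v ^ 2)) * (w k * Real.exp (r * v ^ 2 - r * u ^ 2)) := by
          rw [mul_left_comm, ← Real.exp_add]
          congr 2
          ring
      _ ≤ Real.exp (-(r * v ^ 2)) * (w k * (1 + 2 * r * v * (v - u))) :=
          mul_le_mul_of_nonneg_left (mul_le_mul_of_nonneg_left hexp (hw k hk)) (Real.exp_pos _).le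
      _ = _ := by ring
  refine (Finset.sum_le_sum hterm).trans (le_of_eq ?_)
  rw [← Finset.mul_sum, Finset.sum_add_distrib, ← Finset.mul_sum, Finset.sum_sub_distrib,
    ← Finset.sum_mul, hsum, ← hv']
  ring

/-- The growth in round `t` of the exponentiated excess of the forecasts over the comparator `c`,
when the target is `θ` and the noise is `e`. -/
noncomputable def growth (n : ℕ) (η : ℝ) (i : ℕ → ℕ) (θ c e : ℕ → ℝ) (t : ℕ) : ℝ :=
  saaMix (pool n) (fun s => awake n (i s)) (loss η i (fun s => θ s + e s)) t
    * Real.exp (η * (θ t + e t - c t) ^ 2 - 2 * η * (θ t - c t) ^ 2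
      + η / 4 * (θ t - forecast n η i (fun s => θ s + e s) t) ^ 2)

variable {n : ℕ} {η : ℝ} {i : ℕ → ℕ} {θ c : ℕ → ℝ}

lemma growth_nonneg (hn : 1 ≤ n) (e : ℕ → ℝ) (t : ℕ) : 0 ≤ growth n η i θ c e t :=
  mul_nonneg (Finset.sum_nonneg fun _ _ => mul_nonneg (saaW_nonneg (pool_nonempty hn) _ _)
    (Real.exp_pos _).le) (Real.exp_pos _).le

/-- Adaptedness: together with independence of the noise this is what allows conditioning on the
past. -/
lemma growth_congr {e e' : ℕ → ℝ} {t : ℕ} (ht : 1 ≤ t) (h : ∀ s ∈ Finset.Icc 1 t, e s = e' s) :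
    growth n η i θ c e t = growth n η i θ c e' t := by
  have h' : ∀ s ∈ Finset.Icc 1 t, θ s + e s = θ s + e' s := fun s hs => by rw [h s hs]
  have h'' : ∀ s ∈ Finset.Ico 1 t, θ s + e s = θ s + e' s :=
    fun s hs => h' s (Finset.Ico_subset_Icc_self hs)
  unfold growth saaMix
  rw [saaW_loss_congr h'', forecast_congr h'', h t (by simp [ht])]
  congr 1
  exact Finset.sum_congr rfl fun I _ => by rw [loss_congr h' ht]

lemma measurable_growth (t : ℕ) : Measurable fun e : ℕ → ℝ => growth n η i θ c e t := by
  have hy : ∀ s, Measurable fun e : ℕ → ℝ => θ s + e s :=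
    fun s => (measurable_pi_apply s).const_add _
  have h1 := measurable_forecast (n := n) (η := η) (i := i) hy t
  exact (measurable_saaMix (fun s I => measurable_loss hy s I) t).mul (Measurable.exp
    ((((((hy t).sub_const _).pow_const 2).const_mul _).sub_const _).add
      (((h1.const_sub _).pow_const 2).const_mul _)))

/-- Conditionally on a bounded past, the growth factor has mean at most one. -/
lemma lintegral_growth_le_one (hn : 1 ≤ n) {v : NNReal} (hη : 0 < η) (hv : 4 * (η * v) ≤ 3 / 4)
    {B b : ℝ} (hB : 0 ≤ B) (hb : 0 ≤ b) (hD : η * (2 * B + b) ^ 2 ≤ 1) {t : ℕ}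
    (hi : i t ∈ Finset.Icc 1 n)
    (hθ : ∀ s ∈ Finset.Icc 1 t, |θ s| ≤ B) (ht : 1 ≤ t) {h : ℕ → ℝ}
    (hh : ∀ s ∈ Finset.Ico 1 t, |h s| ≤ b) :
    ∫⁻ x, ENNReal.ofReal (growth n η i θ c (Function.update h t x) t) ∂(gaussianReal 0 v) ≤ 1 := by
  set y := fun s => θ s + h s with hy
  set A := fun s => awake n (i s) with hA
  set w := saaW (pool n) A (loss η i y) t with hw
  set F := forecast n η i y t with hF
  have hup : ∀ x, ∀ s ∈ Finset.Ico 1 t, θ s + Function.update h t x s = y s := fun x s hs => by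
    rw [Function.update_of_ne (by simp at hs; omega)]
  have hw0 : ∀ I ∈ A t, 0 ≤ w I := fun I _ => saaW_nonneg (pool_nonempty hn) _ _
  have hw1 : ∑ I ∈ A t, w I = 1 := sum_saaW (pool_nonempty hn) (awake_nonempty hi)
  set κ : Finset ℕ → ℝ := fun I => -(η * (θ t - expert i y I t) ^ 2) + η * (θ t - c t) ^ 2
    - 2 * η * (θ t - c t) ^ 2 + η / 4 * (θ t - F) ^ 2 with hκ
  -- The terms `-η x²` from the loss and `η x²` from the comparator cancel, so the exponent is
  -- affine in the fresh noise `x`, with constant part `κ I`.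
  have hexpand : ∀ x, growth n η i θ c (Function.update h t x) t
      = ∑ I ∈ A t, w I * Real.exp (κ I)
          * Real.exp ((-(2 * η * (c t - expert i y I t))) * x) := by
    intro x
    unfold growth saaMix
    rw [saaW_loss_congr (hup x), forecast_congr (hup x), Finset.sum_mul]
    refine Finset.sum_congr rfl fun I _ => ?_
    rw [loss, expert_congr (hup x), mul_assoc (w I), mul_assoc (saaW _ _ _ _ _), ← Real.exp_add,
      ← Real.exp_add]
    simp only [Function.update_self]
    congr 2
    simp only [hκ]
    ring
  have hint : ∀ I ∈ A t, Integrable (fun x => w I * Real.exp (κ I)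
          * Real.exp ((-(2 * η * (c t - expert i y I t))) * x)) (gaussianReal 0 v) :=
    fun I _ => (integrable_exp_mul_gaussianReal _).const_mul _
  have hmgf : ∀ r : ℝ, ∫ x, Real.exp (r * x) ∂(gaussianReal 0 v) = Real.exp (v * r ^ 2 / 2) := by
    intro r
    have := congrFun (mgf_fun_id_gaussianReal (μ := 0) (v := v)) r
    simpa [mgf] using this
  simp only [hexpand]
  rw [← ofReal_integral_eq_lintegral_ofReal (integrable_finsetSum _ hint)
    (Filter.Eventually.of_forall fun x => Finset.sum_nonneg fun I hI =>
      mul_nonneg (mul_nonneg (hw0 I hI) (Real.exp_pos _).le) (Real.exp_pos _).le),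
    integral_finsetSum _ hint, ENNReal.ofReal_le_one]
  simp only [integral_const_mul, hmgf]
  have hexpert : ∀ I, |θ t - expert i y I t| ≤ 2 * B + b := by
    intro I
    have h1 : |expert i y I t| ≤ B + b := abs_expert_le (by positivity) fun s hs =>
      (abs_add_le _ _).trans (add_le_add (hθ s (Finset.Ico_subset_Icc_self hs)) (hh s hs))
    have h2 := hθ t (by simp [ht])
    have := abs_sub (θ t) (expert i y I t)
    linarith
  -- The Gaussian integral contributes `2 η² v (c - a)²`, at most `(3/4) η ((θ - c)² + (θ - a)²)` by
  -- the bound on `η v`. The credit `-2η (θ - c)²` built into `growth` absorbs the comparator part,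
  -- and `-(η/4) (θ - a)²` survives.
  have hterm : ∀ I ∈ A t, w I * Real.exp (κ I)
        * Real.exp (v * (-(2 * η * (c t - expert i y I t))) ^ 2 / 2)
      ≤ w I * Real.exp (-(η / 4 * (θ t - expert i y I t) ^ 2))
          * Real.exp (η / 4 * (θ t - F) ^ 2) := by
    intro I hI
    rw [mul_assoc (w I), mul_assoc (w I), ← Real.exp_add, ← Real.exp_add]
    refine mul_le_mul_of_nonneg_left (Real.exp_le_exp.mpr ?_) (hw0 I hI)
    simp only [hκ]
    set a := expert i y I t
    have h1 : (c t - a) ^ 2 ≤ 2 * (θ t - c t) ^ 2 + 2 * (θ t - a) ^ 2 := by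
      nlinarith [sq_nonneg ((θ t - c t) + (θ t - a))]
    have h2 : η * (4 * (η * v)) * (c t - a) ^ 2
        ≤ η * (3 / 4) * (2 * (θ t - c t) ^ 2 + 2 * (θ t - a) ^ 2) :=
      mul_le_mul (mul_le_mul_of_nonneg_left hv hη.le) h1 (sq_nonneg _) (by positivity)
    have h3 : (v : ℝ) * (-(2 * η * (c t - a))) ^ 2 / 2
        = η * (4 * (η * v)) * (c t - a) ^ 2 / 2 := by ring
    rw [h3]
    have h4 : 0 ≤ η * (θ t - c t) ^ 2 := by positivity
    nlinarith
  refine (Finset.sum_le_sum hterm).trans ?_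
  rw [← Finset.sum_mul]
  have hmix := sum_mul_exp_neg_sq_le (A t) w (fun I => expert i y I t) hw0 hw1
    (r := η / 4) (by positivity) (fun I _ => hexpert I) (by linarith)
  have hFe : ∑ I ∈ A t, w I * expert i y I t = F := rfl
  rw [hFe] at hmix
  calc _ ≤ Real.exp (-(η / 4 * (θ t - F) ^ 2)) * Real.exp (η / 4 * (θ t - F) ^ 2) :=
        mul_le_mul_of_nonneg_right hmix (Real.exp_pos _).le
    _ = 1 := by rw [← Real.exp_add]; simp

/-- The accumulated growth over `t` rounds, set to zero once the noise has exceeded `b`. -/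
noncomputable def stoppedGrowth (n : ℕ) (η : ℝ) (i : ℕ → ℕ) (θ c : ℕ → ℝ) (b : ℝ) (t : ℕ)
    (e : ℕ → ℝ) : ENNReal :=
  {e : ℕ → ℝ | ∀ s ∈ Finset.Icc 1 t, |e s| ≤ b}.indicator
    (fun e => ENNReal.ofReal (∏ s ∈ Finset.Icc 1 t, growth n η i θ c e s)) e

lemma measurable_stoppedGrowth (b : ℝ) (t : ℕ) :
    Measurable (stoppedGrowth n η i θ c b t) := by
  refine Measurable.indicator
    (Finset.measurable_prod _ fun s _ => measurable_growth s).ennreal_ofReal ?_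
  have : {e : ℕ → ℝ | ∀ s ∈ Finset.Icc 1 t, |e s| ≤ b}
      = ⋂ s ∈ Finset.Icc 1 t, {e : ℕ → ℝ | |e s| ≤ b} := by ext; simp
  rw [this]
  refine Finset.measurableSet_biInter _ fun s _ => measurableSet_le ?_ measurable_const
  exact (measurable_pi_apply s).abs

lemma stoppedGrowth_congr {b : ℝ} {t : ℕ} {e e' : ℕ → ℝ}
    (h : ∀ s ∈ Finset.Icc 1 t, e s = e' s) :
    stoppedGrowth n η i θ c b t e = stoppedGrowth n η i θ c b t e' := by
  have h1 : (∀ s ∈ Finset.Icc 1 t, |e s| ≤ b) ↔ ∀ s ∈ Finset.Icc 1 t, |e' s| ≤ b :=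
    forall₂_congr fun s hs => by rw [h s hs]
  have h2 : ∏ s ∈ Finset.Icc 1 t, growth n η i θ c e s
      = ∏ s ∈ Finset.Icc 1 t, growth n η i θ c e' s := by
    refine Finset.prod_congr rfl fun s hs => growth_congr (Finset.mem_Icc.mp hs).1 fun r hr => ?_
    refine h r ?_
    simp only [Finset.mem_Icc] at *
    omega
  classical
  simp only [stoppedGrowth, Set.indicator_apply, Set.mem_ofPred_eq, h1, h2]

/-- Only the constraint on the newest noise variable is dropped. The factor of the new round can
then be integrated over the whole line, with its moment generating function unaffected by
truncation. -/
lemma stoppedGrowth_succ_le (hn : 1 ≤ n) {b : ℝ} {t : ℕ} (h : ℕ → ℝ) (x : ℝ) :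
    stoppedGrowth n η i θ c b (t + 1) (Function.update h (t + 1) x)
      ≤ stoppedGrowth n η i θ c b t h
        * ENNReal.ofReal (growth n η i θ c (Function.update h (t + 1) x) (t + 1)) := by
  have hc : ∀ s ∈ Finset.Icc 1 t, Function.update h (t + 1) x s = h s := fun s hs =>
    Function.update_of_ne (by simp at hs; omega) _ _
  rw [← stoppedGrowth_congr hc]
  classical
  unfold stoppedGrowth
  rw [Set.indicator_apply]
  split_ifs with h1
  · rw [Set.indicator_of_mem, ← Finset.insert_Icc_right_eq_Icc_add_one (by omega),
      Finset.prod_insert (by simp), mul_comm,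
      ENNReal.ofReal_mul (Finset.prod_nonneg fun s _ => growth_nonneg hn _ s)]
    intro s hs
    exact h1 s (Finset.Icc_subset_Icc_right (by omega) hs)
  · exact zero_le

/-! ### Independence of the noise and Markov's inequality. -/

/-- Integrating out an independent variable. -/
lemma lintegral_le_of_indepFun {Ω α : Type*} [MeasurableSpace Ω] {μ : Measure Ω}
    [IsProbabilityMeasure μ] [MeasurableSpace α] {H : Ω → α} {X : Ω → ℝ}
    {ν : Measure ℝ} [SFinite ν] (hH : AEMeasurable H μ) (hX : HasLaw X ν μ) (hHX : IndepFun H X μ)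
    {g : α × ℝ → ENNReal} {φ : α → ENNReal} (hg : Measurable g) (hφ : Measurable φ)
    (h : ∀ a, ∫⁻ x, g (a, x) ∂ν ≤ φ a) :
    ∫⁻ ω, g (H ω, X ω) ∂μ ≤ ∫⁻ ω, φ (H ω) ∂μ := by
  have hlaw := (indepFun_iff_map_prod_eq_prod_map_map hH hX.aemeasurable).mp hHX
  rw [hX.map_eq] at hlaw
  calc ∫⁻ ω, g (H ω, X ω) ∂μ = ∫⁻ p, g p ∂(μ.map fun ω => (H ω, X ω)) :=
        (lintegral_map' hg.aemeasurable (hH.prodMk hX.aemeasurable)).symm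
    _ = ∫⁻ a, ∫⁻ x, g (a, x) ∂ν ∂(μ.map H) := by
        rw [hlaw, lintegral_prod _ hg.aemeasurable]
    _ ≤ ∫⁻ a, φ a ∂(μ.map H) := lintegral_mono h
    _ = _ := lintegral_map' hφ.aemeasurable hH

/-- The noise of the first `t` rounds, as a sequence. -/
noncomputable def noiseUpTo {Ω : Type*} (ε : ℕ → Ω → ℝ) (t : ℕ) (ω : Ω) (s : ℕ) : ℝ :=
  if s ∈ Finset.Icc 1 t then ε s ω else 0

lemma noiseUpTo_succ {Ω : Type*} {ε : ℕ → Ω → ℝ} (t : ℕ) (ω : Ω) :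
    noiseUpTo ε (t + 1) ω = Function.update (noiseUpTo ε t ω) (t + 1) (ε (t + 1) ω) := by
  funext s
  by_cases hs : s = t + 1
  · subst hs
    simp [noiseUpTo]
  · rw [Function.update_of_ne hs]
    unfold noiseUpTo
    congr 1
    simp only [Finset.mem_Icc, eq_iff_iff]
    omega

variable {Ω : Type*} [MeasurableSpace Ω] {μ : Measure Ω} {ε : ℕ → Ω → ℝ}

lemma aemeasurable_noiseUpTo {t : ℕ} (hε : ∀ s ∈ Finset.Icc 1 t, AEMeasurable (ε s) μ) :
    AEMeasurable (noiseUpTo ε t) μ := by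
  refine aemeasurable_pi_lambda _ fun s => ?_
  unfold noiseUpTo
  split_ifs with hs
  · exact hε s hs
  · exact aemeasurable_const

lemma indepFun_noiseUpTo (hε : ∀ t ∈ Finset.Icc 1 n, AEMeasurable (ε t) μ)
    (hind : iIndepFun (fun (t : Finset.Icc 1 n) => ε t) μ) {t : ℕ} (ht : t + 1 ≤ n) :
    IndepFun (noiseUpTo ε t) (ε (t + 1)) μ := by
  classical
  let last : Finset.Icc 1 n := ⟨t + 1, by simp [ht]⟩
  let S : Finset (Finset.Icc 1 n) := Finset.univ.filter (fun s => (s : ℕ) ≤ t)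
  have hST : Disjoint S {last} := by
    rw [Finset.disjoint_singleton_right]
    simp [S, last]
  have h := hind.indepFun_finset₀ S {last} hST fun s => hε s s.2
  let φ : (S → ℝ) → ℕ → ℝ := fun z s =>
    if hs : s ∈ Finset.Icc 1 t then
      z ⟨⟨s, by simp only [Finset.mem_Icc] at hs ⊢; omega⟩, by simp [S] at hs ⊢; omega⟩ else 0
  have hφ : Measurable φ := by
    refine measurable_pi_lambda _ fun s => ?_
    by_cases hs : s ∈ Finset.Icc 1 t
    · simp only [φ, dif_pos hs]
      exact measurable_pi_apply _
    · simp only [φ, dif_neg hs]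
      exact measurable_const
  have hcomp := h.comp hφ (measurable_pi_apply (⟨last, by simp⟩ : ({last} : Finset _)))
  exact hcomp

/-- The supermartingale property in integrated form: the last noise variable is independent of the
earlier ones, and integrating it out does not increase the expectation. -/
lemma lintegral_stoppedGrowth_le_one [IsProbabilityMeasure μ] (hn : 1 ≤ n) {v : NNReal} (hη : 0 < η)
    (hv : 4 * (η * v) ≤ 3 / 4) {B b : ℝ} (hB : 0 ≤ B) (hb : 0 ≤ b)
    (hD : η * (2 * B + b) ^ 2 ≤ 1) (hi : ∀ t ∈ Finset.Icc 1 n, i t ∈ Finset.Icc 1 n)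
    (hθ : ∀ t ∈ Finset.Icc 1 n, |θ t| ≤ B)
    (hε : ∀ t ∈ Finset.Icc 1 n, HasLaw (ε t) (gaussianReal 0 v) μ)
    (hind : iIndepFun (fun (t : Finset.Icc 1 n) => ε t) μ) (t : ℕ) (ht : t ≤ n) :
    ∫⁻ ω, stoppedGrowth n η i θ c b t (noiseUpTo ε t ω) ∂μ ≤ 1 := by
  induction t with
  | zero => simp [stoppedGrowth]
  | succ t ih =>
    refine le_trans ?_ (ih (by omega))
    simp only [noiseUpTo_succ]
    have hup : Measurable fun p : (ℕ → ℝ) × ℝ => Function.update p.1 (t + 1) p.2 := by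
      refine measurable_pi_lambda _ fun s => ?_
      by_cases hs : s = t + 1
      · subst hs
        simpa using measurable_snd
      · simp only [Function.update_of_ne hs]
        exact (measurable_pi_apply s).comp measurable_fst
    refine lintegral_le_of_indepFun
      (g := fun p => stoppedGrowth n η i θ c b (t + 1) (Function.update p.1 (t + 1) p.2))
      (aemeasurable_noiseUpTo fun s hs => (hε s ?_).aemeasurable)
      (hε (t + 1) (by simp [ht]))
      (indepFun_noiseUpTo (fun s hs => (hε s hs).aemeasurable) hind ht)
      ((measurable_stoppedGrowth b (t + 1)).comp hup) (measurable_stoppedGrowth b t) fun h => ?_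
    · simp only [Finset.mem_Icc] at hs ⊢; omega
    have hm : Measurable fun x : ℝ =>
        ENNReal.ofReal (growth n η i θ c (Function.update h (t + 1) x) (t + 1)) :=
      ((measurable_growth (t + 1)).comp (hup.comp measurable_prodMk_left)).ennreal_ofReal
    calc ∫⁻ x, stoppedGrowth n η i θ c b (t + 1) (Function.update h (t + 1) x) ∂(gaussianReal 0 v)
        ≤ ∫⁻ x, stoppedGrowth n η i θ c b t h * ENNReal.ofReal
            (growth n η i θ c (Function.update h (t + 1) x) (t + 1)) ∂(gaussianReal 0 v) :=
          lintegral_mono fun x => stoppedGrowth_succ_le hn h x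
      _ = stoppedGrowth n η i θ c b t h * ∫⁻ x, ENNReal.ofReal
            (growth n η i θ c (Function.update h (t + 1) x) (t + 1)) ∂(gaussianReal 0 v) :=
          lintegral_const_mul _ hm
      _ ≤ stoppedGrowth n η i θ c b t h := by
          -- The conditional bound holds only for a past bounded by `b`; otherwise the process has
          -- already been set to zero.
          by_cases hh : ∀ s ∈ Finset.Icc 1 t, |h s| ≤ b
          · refine mul_le_of_le_one_right' (lintegral_growth_le_one hn hη hv hB hb hD
              (hi (t + 1) (by simp [ht])) (fun s hs => hθ s ?_) (by omega) fun s hs => hh s ?_)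
            · simp only [Finset.mem_Icc] at hs ⊢; omega
            · simp only [Finset.mem_Icc, Finset.mem_Ico] at hs ⊢; omega
          · have : stoppedGrowth n η i θ c b t h = 0 := by
              unfold stoppedGrowth
              exact Set.indicator_of_notMem (by exact hh) _
            simp [this]

/-- Markov's inequality at the horizon: large accumulated growth with bounded noise is rare. -/
lemma measureReal_le_prod_growth_le [IsProbabilityMeasure μ] (hn : 1 ≤ n) {v : NNReal} (hη : 0 < η)
    (hv : 4 * (η * v) ≤ 3 / 4) {B b : ℝ} (hB : 0 ≤ B) (hb : 0 ≤ b)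
    (hD : η * (2 * B + b) ^ 2 ≤ 1) (hi : ∀ t ∈ Finset.Icc 1 n, i t ∈ Finset.Icc 1 n)
    (hθ : ∀ t ∈ Finset.Icc 1 n, |θ t| ≤ B)
    (hε : ∀ t ∈ Finset.Icc 1 n, HasLaw (ε t) (gaussianReal 0 v) μ)
    (hind : iIndepFun (fun (t : Finset.Icc 1 n) => ε t) μ) {a : ℝ} (ha : 0 < a) :
    μ.real {ω | (∀ t ∈ Finset.Icc 1 n, |ε t ω| ≤ b) ∧
      a ≤ ∏ t ∈ Finset.Icc 1 n, growth n η i θ c (fun s => ε s ω) t} ≤ 1 / a := by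
  have hsub : {ω | (∀ t ∈ Finset.Icc 1 n, |ε t ω| ≤ b) ∧
      a ≤ ∏ t ∈ Finset.Icc 1 n, growth n η i θ c (fun s => ε s ω) t}
      ⊆ {ω | ENNReal.ofReal a ≤ stoppedGrowth n η i θ c b n (noiseUpTo ε n ω)} := by
    rintro ω ⟨h1, h2⟩
    have hc : stoppedGrowth n η i θ c b n (noiseUpTo ε n ω)
        = stoppedGrowth n η i θ c b n (fun s => ε s ω) :=
      stoppedGrowth_congr fun s hs => by simp only [noiseUpTo, if_pos hs]
    rw [Set.mem_ofPred_eq, hc, stoppedGrowth, Set.indicator_of_mem (by exact h1)]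
    exact ENNReal.ofReal_le_ofReal h2
  have hmeas : AEMeasurable (fun ω => stoppedGrowth n η i θ c b n (noiseUpTo ε n ω)) μ :=
    (measurable_stoppedGrowth b n).comp_aemeasurable
      (aemeasurable_noiseUpTo fun s hs => (hε s hs).aemeasurable)
  have hmarkov := meas_ge_le_lintegral_div hmeas (ENNReal.ofReal_pos.mpr ha).ne'
    ENNReal.ofReal_ne_top
  have h1 := lintegral_stoppedGrowth_le_one (c := c) hn hη hv hB hb hD hi hθ hε hind n le_rfl
  refine ENNReal.toReal_le_of_le_ofReal (by positivity) ((measure_mono hsub).trans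
    (hmarkov.trans ((ENNReal.div_le_div_right h1 _).trans ?_)))
  rw [ENNReal.ofReal_div_of_pos ha, ENNReal.ofReal_one]

/-! ### Gaussian tails. -/

lemma gaussianReal_abs_gt_le {v : NNReal} {σ L : ℝ} (hvσ : (v : ℝ) = σ ^ 2) (hσ : 0 ≤ σ)
    (hL : 0 ≤ L) :
    (gaussianReal 0 v).real {x | 2 * σ * √L < |x|}
      ≤ 2 * Real.exp (-(2 * L)) := by
  rcases hσ.eq_or_lt with rfl | hσ
  · obtain rfl : v = 0 := by simpa using hvσ
    rw [gaussianReal_zero_var, measureReal_def,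
      Measure.dirac_apply' _ (measurableSet_lt measurable_const (by fun_prop))]
    simp
    positivity
  have hs := Real.mul_self_sqrt hL
  -- The optimal Chernoff parameter, threshold divided by variance; it requires `σ > 0`, the case `σ
  -- = 0` being a Dirac mass.
  set s := 2 * √L / σ
  have hs0 : 0 ≤ s := by positivity
  have hmgf : ∀ r, mgf (fun x => x) (gaussianReal 0 v) r = Real.exp (σ ^ 2 * r ^ 2 / 2) := by
    intro r
    rw [mgf_fun_id_gaussianReal]
    simp [hvσ]
  have h1 := measure_ge_le_exp_mul_mgf (X := fun x => x) (μ := gaussianReal 0 v) (2 * σ * √L) hs0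
    (integrable_exp_mul_gaussianReal s)
  have h2 := measure_le_le_exp_mul_mgf (X := fun x => x) (μ := gaussianReal 0 v) (-(2 * σ * √L))
    (neg_nonpos.mpr hs0) (integrable_exp_mul_gaussianReal (-s))
  have e1 : -s * (2 * σ * √L) + σ ^ 2 * s ^ 2 / 2 = -(2 * L) := by
    simp only [s]
    field_simp
    nlinarith
  rw [hmgf, ← Real.exp_add, e1] at h1
  rw [hmgf, ← Real.exp_add, neg_sq, neg_neg,
    show s * -(2 * σ * √L) = -s * (2 * σ * √L) by ring, e1] at h2
  have hsub : {x : ℝ | 2 * σ * √L < |x|} ⊆ {x | 2 * σ * √L ≤ x} ∪ {x | x ≤ -(2 * σ * √L)} := by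
    intro x hx
    rw [Set.mem_ofPred_eq] at hx
    rcases lt_abs.mp hx with h | h
    · exact Or.inl h.le
    · exact Or.inr (by simp only [Set.mem_ofPred_eq]; linarith)
  calc (gaussianReal 0 v).real {x | 2 * σ * √L < |x|}
      ≤ _ := measureReal_mono hsub
    _ ≤ _ := measureReal_union_le _ _
    _ ≤ _ := by linarith

lemma measureReal_exists_abs_gt_le {v : NNReal} {σ L : ℝ} (hvσ : (v : ℝ) = σ ^ 2) (hσ : 0 ≤ σ) (hL : 0 ≤ L)
    (hε : ∀ t ∈ Finset.Icc 1 n, HasLaw (ε t) (gaussianReal 0 v) μ) :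
    μ.real {ω | ∃ t ∈ Finset.Icc 1 n, 2 * σ * √L < |ε t ω|} ≤ n * (2 * Real.exp (-(2 * L))) := by
  have hset : {ω | ∃ t ∈ Finset.Icc 1 n, 2 * σ * √L < |ε t ω|}
      = ⋃ t ∈ Finset.Icc 1 n, {ω | 2 * σ * √L < |ε t ω|} := by ext; simp
  rw [hset]
  calc _ ≤ ∑ t ∈ Finset.Icc 1 n, μ.real {ω | 2 * σ * √L < |ε t ω|} :=
        measureReal_biUnion_finset_le _ _
    _ ≤ ∑ t ∈ Finset.Icc 1 n, 2 * Real.exp (-(2 * L)) := by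
        refine Finset.sum_le_sum fun t ht => ?_
        rw [(hε t ht).measureReal_eq (p := fun x => 2 * σ * √L < |x|)
          (measurableSet_lt measurable_const measurable_id.abs)]
        exact gaussianReal_abs_gt_le hvσ hσ hL
    _ = _ := by simp

/-! ### Pathwise regret and choice of constants. -/

/-- The regret bound on a realization of the noise, against the maximal flat intervals. -/
lemma sum_sq_forecast_sub_le {n : ℕ} (hn : 1 ≤ n) {η : ℝ} (hη : 0 < η) {i : ℕ → ℕ}
    (hi : ∀ t ∈ Finset.Icc 1 n, i t ∈ Finset.Icc 1 n) {g e : ℕ → ℝ} {M a : ℝ} (hM : 0 ≤ M)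
    (hy : ∀ t ∈ Finset.Icc 1 n, |g (i t) + e t| ≤ M)
    (ha : ∏ t ∈ Finset.Icc 1 n, growth n η i (fun t => g (i t))
      (fun t => g (sInf (flatInterval n i g (i t) : Set ℕ))) e t ≤ a) :
    η / 4 * ∑ t ∈ Finset.Icc 1 n, (forecast n η i (fun s => g (i s) + e s) t - g (i t)) ^ 2
      ≤ Real.log a + ((Finset.Icc 1 n).image (flatInterval n i g)).card
        * (2 * Real.log n + η * (4 * M ^ 2 * (1 + Real.log n)) + 2 * η) := by
  set y := fun s => g (i s) + e s with hydef
  set c : Finset ℕ → ℝ := fun I => g (sInf (I : Set ℕ)) with hc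
  set P := (Finset.Icc 1 n).image (flatInterval n i g) with hP
  set m := saaMix (pool n) (fun s => awake n (i s)) (loss η i y) with hm
  have hm0 : ∀ t ∈ Finset.Icc 1 n, 0 < m t := by
    intro t ht
    obtain ⟨s, rfl⟩ : ∃ s, t = s + 1 := ⟨t - 1, by simp at ht; omega⟩
    exact saaMix_succ_pos (pool_nonempty hn) (awake_nonempty (hi _ ht))
  have hgpos : ∀ t ∈ Finset.Icc 1 n, 0 < growth n η i (fun t => g (i t))
      (fun t => g (sInf (flatInterval n i g (i t) : Set ℕ))) e t := fun t ht =>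
    mul_pos (hm0 t ht) (Real.exp_pos _)
  have hlog := Real.log_le_log (Finset.prod_pos hgpos) ha
  rw [Real.log_prod fun t ht => (hgpos t ht).ne'] at hlog
  have hlg : ∀ t ∈ Finset.Icc 1 n, Real.log (growth n η i (fun t => g (i t))
      (fun t => g (sInf (flatInterval n i g (i t) : Set ℕ))) e t)
      = η / 4 * (forecast n η i y t - g (i t)) ^ 2
        - (-Real.log (m t) - η * (y t - c (flatInterval n i g (i t))) ^ 2
          + 2 * η * (g (i t) - c (flatInterval n i g (i t))) ^ 2) := by
    intro t ht
    rw [growth, Real.log_mul (hm0 t ht).ne' (Real.exp_pos _).ne', Real.log_exp]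
    simp only [hm, hc, hydef]
    ring
  rw [Finset.sum_congr rfl hlg, Finset.sum_sub_distrib, ← Finset.mul_sum] at hlog
  have hfib := Finset.sum_fiberwise_of_maps_to (s := Finset.Icc 1 n) (t := P)
    (g := fun t => flatInterval n i g (i t))
    (fun t ht => Finset.mem_image_of_mem _ (hi t ht))
    (fun t => -Real.log (m t) - η * (y t - c (flatInterval n i g (i t))) ^ 2
          + 2 * η * (g (i t) - c (flatInterval n i g (i t))) ^ 2)
  -- On one block of the partition the expert `I` is awake in exactly the rounds of the block. Its
  -- aggregation regret, its averaging regret and the bias of the constant `c I` give the three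
  -- summands.
  have hI : ∀ I ∈ P, ∑ t ∈ (Finset.Icc 1 n).filter (fun t => flatInterval n i g (i t) = I),
      (-Real.log (m t) - η * (y t - c (flatInterval n i g (i t))) ^ 2
          + 2 * η * (g (i t) - c (flatInterval n i g (i t))) ^ 2)
      ≤ 2 * Real.log n + η * (4 * M ^ 2 * (1 + Real.log n)) + 2 * η := by
    intro I hI
    obtain ⟨j, hj, rfl⟩ := Finset.mem_image.mp hI
    set I := flatInterval n i g j with hIdef
    have hIp : I ∈ pool n := (Finset.mem_filter.mp (flatInterval_mem_awake hj)).1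
    have hset : (Finset.Icc 1 n).filter (fun t => flatInterval n i g (i t) = I)
        = (Finset.Icc 1 n).filter (fun t => i t ∈ I) := by
      refine Finset.filter_congr fun t ht => ⟨fun h => h ▸ mem_flatInterval (i t), fun h => ?_⟩
      exact flatInterval_eq_of_mem hj (hi t ht) h
    have hset' : (Finset.Icc 1 n).filter (fun t => I ∈ awake n (i t))
        = (Finset.Icc 1 n).filter (fun t => i t ∈ I) := by
      refine Finset.filter_congr fun t _ => ?_
      simp [awake, hIp]
    have h1 := sum_neg_log_saaMix_le (ℓ := loss η i y) (A := fun s => awake n (i s))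
      (pool_nonempty hn) (fun s => Finset.filter_subset _ _) hIp n
    rw [hset', ← hm] at h1
    have h2 := mul_le_mul_of_nonneg_left
      (sum_sq_sub_expert_le (i := i) (y := y) (I := I) hM (c I) n hy) hη.le
    have h3 := mul_le_mul_of_nonneg_left (sum_sq_sub_flatInterval_le (i := i) (g := g) hj)
      (by positivity : 0 ≤ 2 * η)
    have h4 : Real.log (pool n).card ≤ 2 * Real.log n := by
      have hle : ((pool n).card : ℝ) ≤ (n : ℝ) ^ 2 := by exact_mod_cast card_pool_le n
      have := Real.log_le_log (by exact_mod_cast (pool_nonempty hn).card_pos) hle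
      rwa [Real.log_pow, Nat.cast_ofNat] at this
    have h5 : ∑ t ∈ (Finset.Icc 1 n).filter (fun t => i t ∈ I), loss η i y t I
        = η * ∑ t ∈ (Finset.Icc 1 n).filter (fun t => i t ∈ I), (y t - expert i y I t) ^ 2 := by
      rw [Finset.mul_sum]
      rfl
    have h6 : ∑ t ∈ (Finset.Icc 1 n).filter (fun t => flatInterval n i g (i t) = I),
        (-Real.log (m t) - η * (y t - c (flatInterval n i g (i t))) ^ 2
          + 2 * η * (g (i t) - c (flatInterval n i g (i t))) ^ 2)
        = ∑ t ∈ (Finset.Icc 1 n).filter (fun t => i t ∈ I), -Real.log (m t)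
          - η * ∑ t ∈ (Finset.Icc 1 n).filter (fun t => i t ∈ I), (y t - c I) ^ 2
          + 2 * η * ∑ t ∈ (Finset.Icc 1 n).filter (fun t => i t ∈ I), (g (i t) - c I) ^ 2 := by
      rw [Finset.mul_sum, Finset.mul_sum, ← Finset.sum_sub_distrib, ← Finset.sum_add_distrib,
        ← hset]
      refine Finset.sum_congr rfl fun t ht => ?_
      rw [(Finset.mem_filter.mp ht).2]
    rw [h6]
    rw [← hIdef] at h3
    simp only [hc] at h2 h3 ⊢
    linarith
  have hsum := Finset.sum_le_sum hI
  rw [hfib, Finset.sum_const, nsmul_eq_mul] at hsum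
  linarith

lemma natLog_two_add_one_le {n : ℕ} (hn : 1 ≤ n) : (Nat.log 2 n + 1 : ℝ) ≤ 2 * (1 + Real.log n) := by
  have h1 : ((2 : ℝ) ^ Nat.log 2 n) ≤ n := by exact_mod_cast Nat.pow_log_le_self 2 (by omega)
  have h2 := Real.log_le_log (by positivity) h1
  rw [Real.log_pow] at h2
  have h3 := Real.log_two_gt_d9
  have h4 : (0 : ℝ) ≤ Nat.log 2 n := Nat.cast_nonneg _
  nlinarith

/-- With the learning rate of the algorithm the realized regret is polylogarithmic in `n / δ`. -/
lemma sum_sq_forecast_rate_le {n : ℕ} (hn : 1 ≤ n) {B σ δ C : ℝ} (hB : 0 < B) (hσ : 0 ≤ σ)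
    (hδ : 0 < δ) (hδ' : δ < 1) {i : ℕ → ℕ} (hi : ∀ t ∈ Finset.Icc 1 n, i t ∈ Finset.Icc 1 n)
    {g e : ℕ → ℝ} (hg : ∀ j ∈ Finset.Icc 1 n, |g j| ≤ B)
    (hC : ∑ j ∈ Finset.Icc 2 n, |g j - g (j - 1)| ≤ C)
    (he : ∀ t ∈ Finset.Icc 1 n, |e t| ≤ 2 * σ * √(Real.log (2 * n / δ)))
    (ha : ∏ t ∈ Finset.Icc 1 n, growth n (rate B σ δ n) i (fun t => g (i t))
      (fun t => g (sInf (flatInterval n i g (i t) : Set ℕ))) e t ≤ 2 / δ) :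
    ∑ t ∈ Finset.Icc 1 n,
        (forecast n (rate B σ δ n) i (fun s => g (i s) + e s) t - g (i t)) ^ 2
      ≤ (3200 * (B ^ 2 + σ ^ 2) + 64) * (1 + Real.log (n / δ)) ^ 3
        * max 1 ((n : ℝ) ^ (1 / 3 : ℝ) * C ^ (2 / 3 : ℝ)) := by
  have hn' : (1 : ℝ) ≤ n := by exact_mod_cast hn
  set L := Real.log (2 * n / δ) with hL
  set Λ := 1 + Real.log (n / δ) with hΛ
  set X := max 1 ((n : ℝ) ^ (1 / 3 : ℝ) * C ^ (2 / 3 : ℝ)) with hX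
  have hlogn : 0 ≤ Real.log n := Real.log_nonneg hn'
  have hlogδ : Real.log δ ≤ 0 := Real.log_nonpos hδ.le hδ'.le
  have hΛe : Λ = 1 + Real.log n - Real.log δ := by
    rw [hΛ, Real.log_div (by positivity) hδ.ne']; ring
  have hLe : L = Real.log 2 + Real.log n - Real.log δ := by
    rw [hL, Real.log_div (by positivity) hδ.ne', Real.log_mul (by norm_num) (by positivity)]
  have hl2 := Real.log_two_gt_d9
  have hl2' := Real.log_two_lt_d9
  have hL0 : 0 ≤ L := by linarith
  have hLΛ : L ≤ Λ := by linarith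
  have hΛ1 : 1 ≤ Λ := by linarith
  have hX1 : 1 ≤ X := le_max_left _ _
  set r := √L with hr
  have hr0 : 0 ≤ r := Real.sqrt_nonneg _
  have hr2 : r ^ 2 = L := Real.sq_sqrt hL0
  set η := rate B σ δ n with hη
  have hm0 : 0 < B + σ * r := by positivity
  have hηm : η * (8 * (B + σ * r) ^ 2) = 1 := by
    rw [hη, rate, one_div, ← hL, ← hr]
    exact inv_mul_cancel₀ (by positivity)
  have hη0 : 0 < η := by
    rw [hη, rate, ← hL, ← hr]
    positivity
  have hM0 : 0 ≤ B + 2 * σ * r := by positivity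
  have hreg := sum_sq_forecast_sub_le hn hη0 hi hM0 (e := e) (fun t ht =>
    (abs_add_le _ _).trans (add_le_add (hg _ (hi t ht)) (he t ht))) ha
  set R := ∑ t ∈ Finset.Icc 1 n, (forecast n η i (fun s => g (i s) + e s) t - g (i t)) ^ 2
  set N : ℝ := (((Finset.Icc 1 n).image (flatInterval n i g)).card : ℝ)
  have hN0 : 0 ≤ N := Nat.cast_nonneg _
  have hN : N ≤ 8 * Λ * X := by
    refine (card_image_flatInterval_le hC).trans ?_
    have h1 := natLog_two_add_one_le hn
    have h2 : 2 + 2 * ((n : ℝ) ^ (1 / 3 : ℝ) * C ^ (2 / 3 : ℝ)) ≤ 4 * X := by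
      have := le_max_right 1 ((n : ℝ) ^ (1 / 3 : ℝ) * C ^ (2 / 3 : ℝ))
      linarith
    calc _ ≤ (Nat.log 2 n + 1 : ℝ) * (4 * X) := mul_le_mul_of_nonneg_left h2 (by positivity)
      _ ≤ (2 * Λ) * (4 * X) := mul_le_mul_of_nonneg_right (by linarith) (by positivity)
      _ = _ := by ring
  have hηM : η * (4 * (B + 2 * σ * r) ^ 2) ≤ 2 := by
    have : (B + 2 * σ * r) ^ 2 ≤ 4 * (B + σ * r) ^ 2 := by
      have h1 : 0 ≤ B * (σ * r) := by positivity
      have h2 : 0 ≤ B ^ 2 := sq_nonneg B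
      linarith
    have := mul_le_mul_of_nonneg_left this hη0.le
    linarith
  -- `1 / η` is at most a constant times `Λ`. This is the third power of `Λ`; the others come from
  -- the number of scales and from the regret per block.
  have hrec : 1 ≤ η * (16 * (B ^ 2 + σ ^ 2) * Λ) := by
    rw [← hηm]
    refine mul_le_mul_of_nonneg_left ?_ hη0.le
    have h1 : (B + σ * r) ^ 2 ≤ 2 * B ^ 2 + 2 * (σ ^ 2 * L) := by
      have : σ ^ 2 * L = (σ * r) ^ 2 := by rw [mul_pow, hr2]
      rw [this]
      linarith [add_sq_le (a := B) (b := σ * r)]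
    have h2 : σ ^ 2 * L ≤ σ ^ 2 * Λ := mul_le_mul_of_nonneg_left hLΛ (sq_nonneg _)
    have h3 : B ^ 2 * 1 ≤ B ^ 2 * Λ := mul_le_mul_of_nonneg_left hΛ1 (sq_nonneg _)
    linarith
  have hlog2 : Real.log (2 / δ) ≤ Λ := by
    rw [Real.log_div (by norm_num) hδ.ne']
    linarith
  have hΛX : Λ ≤ Λ ^ 2 * X := by
    have := mul_le_mul (mul_le_mul le_rfl hΛ1 zero_le_one (by positivity : 0 ≤ Λ)) hX1 zero_le_one
      (by positivity)
    linarith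
  have hbr : 2 * Real.log n + η * (4 * (B + 2 * σ * r) ^ 2 * (1 + Real.log n)) + 2 * η
      ≤ 4 * Λ + 2 * η := by
    have : η * (4 * (B + 2 * σ * r) ^ 2) * (1 + Real.log n) ≤ 2 * (1 + Real.log n) :=
      mul_le_mul_of_nonneg_right hηM (by positivity)
    linarith
  have hmain : η / 4 * R ≤ 33 * Λ ^ 2 * X + 16 * η * (Λ * X) := by
    calc η / 4 * R ≤ Λ + N * (4 * Λ + 2 * η) := hreg.trans
          (add_le_add hlog2 (mul_le_mul_of_nonneg_left hbr hN0))
      _ ≤ Λ ^ 2 * X + 8 * Λ * X * (4 * Λ + 2 * η) :=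
          add_le_add hΛX (mul_le_mul_of_nonneg_right hN (by positivity))
      _ = _ := by ring
  have hfin : η * R ≤ η * (132 * (16 * (B ^ 2 + σ ^ 2)) * (Λ ^ 3 * X) + 64 * (Λ * X)) := by
    have := mul_le_mul_of_nonneg_right hrec (by positivity : 0 ≤ 132 * Λ ^ 2 * X)
    calc η * R ≤ 1 * (132 * Λ ^ 2 * X) + 64 * η * (Λ * X) := by linarith
      _ ≤ η * (16 * (B ^ 2 + σ ^ 2) * Λ) * (132 * Λ ^ 2 * X) + 64 * η * (Λ * X) := by linarith
      _ = _ := by ring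
  have hR := le_of_mul_le_mul_left hfin hη0
  have hΛ3 : Λ * X ≤ Λ ^ 3 * X :=
    mul_le_mul_of_nonneg_right (le_self_pow₀ hΛ1 (by norm_num)) (by positivity)
  have hpos : 0 ≤ (B ^ 2 + σ ^ 2) * (Λ ^ 3 * X) := by positivity
  linarith

end Aligator

open Aligator in
theorem theorem1 :
    ∃ p : ℕ, ∀ B σ : ℝ, 0 < B → 0 ≤ σ → ∃ K : ℝ,
      ∀ (n : ℕ) (δ : ℝ), 1 ≤ n → 0 < δ → δ < 1 →
      -- the choices of the adversary
      ∀ (x : ℕ → ℝ) (f : ℝ → ℝ) (C : ℝ) (i : ℕ → ℕ),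
        StrictMonoOn x (Set.Icc 1 n) →
        (∀ j ∈ Finset.Icc 1 n, |f (x j)| ≤ B) →
        ∑ j ∈ Finset.Icc 2 n, |f (x j) - f (x (j - 1))| ≤ C →
        (∀ t ∈ Finset.Icc 1 n, i t ∈ Finset.Icc 1 n) →
      -- the noise
      ∀ {Ω : Type*} [MeasurableSpace Ω] (μ : Measure Ω) [IsProbabilityMeasure μ] (ε : ℕ → Ω → ℝ),
        (∀ t ∈ Finset.Icc 1 n, HasLaw (ε t) (gaussianReal 0 ⟨σ ^ 2, sq_nonneg σ⟩) μ) →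
        iIndepFun (fun (t : Finset.Icc 1 n) => ε t) μ →
        1 - δ ≤ μ.real {ω |
          ∑ t ∈ Finset.Icc 1 n,
              (Aligator.forecast n (Aligator.rate B σ δ n) i (fun s => f (x (i s)) + ε s ω) t
                - f (x (i t))) ^ 2
            ≤ K * (1 + Real.log (n / δ)) ^ p
                * max 1 ((n : ℝ) ^ (1 / 3 : ℝ) * C ^ (2 / 3 : ℝ))} := by
  refine ⟨3, fun B σ hB hσ => ⟨3200 * (B ^ 2 + σ ^ 2) + 64, ?_⟩⟩
  intro n δ hn hδ hδ' x f C i _ hg hC hi Ω _ μ _ ε hε hind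
  have hn' : (1 : ℝ) ≤ n := by exact_mod_cast hn
  set L := Real.log (2 * n / δ) with hL
  set v : NNReal := ⟨σ ^ 2, sq_nonneg σ⟩
  have hvσ : (v : ℝ) = σ ^ 2 := rfl
  have hq1 : 2 ≤ 2 * n / δ := by
    rw [le_div_iff₀ hδ]
    nlinarith
  have hL2 : 2 / 3 ≤ L := by
    have := Real.log_le_log (by norm_num) hq1
    have := Real.log_two_gt_d9
    linarith
  have hr2 : (√L) ^ 2 = L := Real.sq_sqrt (by linarith)
  have hη0 : 0 < rate B σ δ n := by
    rw [rate, ← hL]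
    positivity
  have hηm : rate B σ δ n * (8 * (B + σ * √L) ^ 2) = 1 := by
    rw [rate, one_div, ← hL]
    exact inv_mul_cancel₀ (by positivity)
  -- The learning rate gives `8 η σ² L ≤ 1`, and `L ≥ log 2 > 2/3` turns this into `η σ² ≤ 3/16`,
  -- exactly what is needed.
  have hv : 4 * (rate B σ δ n * v) ≤ 3 / 4 := by
    have h1 : σ ^ 2 * L ≤ (B + σ * √L) ^ 2 := by
      have : σ ^ 2 * L = (σ * √L) ^ 2 := by rw [mul_pow, hr2]
      rw [this]
      exact pow_le_pow_left₀ (by positivity) (by linarith) 2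
    have h2 : rate B σ δ n * (8 * (σ ^ 2 * L)) ≤ 1 := by
      rw [← hηm]
      exact mul_le_mul_of_nonneg_left (by linarith) hη0.le
    have h3 : 0 ≤ rate B σ δ n * σ ^ 2 := by positivity
    rw [hvσ]
    nlinarith
  have hD : rate B σ δ n * (2 * B + 2 * σ * √L) ^ 2 ≤ 1 := by
    have : (2 * B + 2 * σ * √L) ^ 2 = 4 * (B + σ * √L) ^ 2 := by ring
    rw [this]
    linarith
  have hbad1 := measureReal_exists_abs_gt_le (n := n) hvσ hσ (by linarith : 0 ≤ L) hε
  have hbad2 := measureReal_le_prod_growth_le (θ := fun t => f (x (i t)))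
    (c := fun t => f (x (sInf (flatInterval n i (fun j => f (x j)) (i t) : Set ℕ))))
    hn hη0 hv hB.le (by positivity : 0 ≤ 2 * σ * √L) hD hi (fun t ht => hg _ (hi t ht)) hε hind
    (by positivity : 0 < 2 / δ)
  -- The factor 2 in the truncation level `2 σ √L` makes the tail `exp(-2L) = (δ / 2n)²`, so the
  -- union bound over the rounds fits in `δ/2`.
  have hexp : (n : ℝ) * (2 * Real.exp (-(2 * L))) ≤ δ / 2 := by
    have : Real.exp (-(2 * L)) = (δ / (2 * n)) ^ 2 := by
      rw [show -(2 * L) = (2 : ℕ) * (-L) by push_cast; ring, Real.exp_nat_mul, Real.exp_neg, hL,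
        Real.exp_log (by positivity), inv_div]
    rw [this]
    have h1 : (n : ℝ) * (2 * (δ / (2 * n)) ^ 2) = δ / 2 * (δ / n) := by
      field_simp
    rw [h1]
    exact mul_le_of_le_one_right (by positivity) (by rw [div_le_one (by positivity)]; linarith)
  rw [one_div_div] at hbad2
  set G := {ω | ∑ t ∈ Finset.Icc 1 n,
              (Aligator.forecast n (Aligator.rate B σ δ n) i (fun s => f (x (i s)) + ε s ω) t
                - f (x (i t))) ^ 2
            ≤ (3200 * (B ^ 2 + σ ^ 2) + 64) * (1 + Real.log (n / δ)) ^ 3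
                * max 1 ((n : ℝ) ^ (1 / 3 : ℝ) * C ^ (2 / 3 : ℝ))} with hG
  set E₁ := {ω | ∃ t ∈ Finset.Icc 1 n, 2 * σ * √L < |ε t ω|} with hE₁
  set E₂ := {ω | (∀ t ∈ Finset.Icc 1 n, |ε t ω| ≤ 2 * σ * √L) ∧ 2 / δ ≤
    ∏ t ∈ Finset.Icc 1 n, growth n (rate B σ δ n) i (fun t => f (x (i t)))
      (fun t => f (x (sInf (flatInterval n i (fun j => f (x j)) (i t) : Set ℕ))))
      (fun s => ε s ω) t} with hE₂
  have hcover : Set.univ ⊆ G ∪ (E₁ ∪ E₂) := by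
    intro ω _
    by_cases h1 : ω ∈ E₁
    · exact Or.inr (Or.inl h1)
    by_cases h2 : ω ∈ E₂
    · exact Or.inr (Or.inr h2)
    refine Or.inl ?_
    have he : ∀ t ∈ Finset.Icc 1 n, |ε t ω| ≤ 2 * σ * √L := by
      intro t ht
      by_contra hlt
      exact h1 ⟨t, ht, not_le.mp hlt⟩
    rw [hE₂, Set.mem_ofPred_eq, not_and, not_le] at h2
    exact sum_sq_forecast_rate_le (g := fun j => f (x j)) (e := fun s => ε s ω) hn hB hσ hδ hδ'
      hi hg hC he (h2 he).le
  have hle := (measureReal_mono (μ := μ) hcover).trans (measureReal_union_le _ _)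
  have hle' := measureReal_union_le (μ := μ) E₁ E₂
  rw [probReal_univ] at hle
  linarith
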